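/- Let $y_1<y_2$ be real and let $u\in H^4(y_1,y_2)$ be real-valued (so $u\in C^3([y_1,y_2])$), and assume **(H1)** $u''(y)\neq 0$ at every $y\in[y_1,y_2]$ with $u'(y)=0$. Put $u_{\min}=\min_{[y_1,y_2]}u$, $u_{\max}=\max_{[y_1,y_2]}u$ and $$\kappa_+=\min\{u''(y): y\in[y_1,y_2],\ u'(y)=0,\ u(y)=u_{\min}\},\qquad \kappa_-=\max\{u''(y): y\in[y_1,y_2],\ u'(y)=0,\ u(y)=u_{\max}\},$$ with $\kappa_+=+\infty$, respectively $\kappa_-=-\infty$, if there is no such $y$. If $u$ attains $u_{\min}$ (respectively $u_{\max}$) at an interior point put $$\mu_+=\min\{u''(y): y\in(y_1,y_2),\ u(y)=u_{\min}\},\qquad \text{respectively}\quad \mu_-=\max\{u''(y): y\in(y_1,y_2),\ u(y)=u_{\max}\}.$$ For $\beta\in\mathbb R$ and $c\in\mathbb R\setminus[u_{\min},u_{\max}]$ let $\lambda_1(c)=\lambda_1(\beta,c)$ be the smallest eigenvalue (which exists) of the Rayleigh--Kuo boundary value problem $$-\phi''+\frac{u''-\beta}{u-c}\,\phi=\lambda\phi,\qquad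 \phi(y_1)=\phi(y_2)=0,\qquad \phi\in H_0^1\cap H^2(y_1,y_2).$$ Then: 1. If $u(y)=u_{\min}$ for some $y\in(y_1,y_2)$, then $\beta_*:=\min\{\tfrac98\kappa_+,\mu_+\}$ is a real number in $(0,\tfrac98\kappa_+]$; one has $\inf_{c<u_{\min}}\lambda_1(c)>-\infty$ for every $\beta\in(0,\beta_*]$, and $\lim_{c\to u_{\min}^-}\lambda_1(c)=-\infty$ for every $\beta\in(\beta_*,\tfrac98\kappa_+]$. 2. If $u(y)=u_{\max}$ for some $y\in(y_1,y_2)$, then $\beta^*:=\max\{\tfrac98\kappa_-,\mu_-\}$ is a real number in $[\tfrac98\kappa_-,0)$; one has $\inf_{c>u_{\max}}\lambda_1(c)>-\infty$ for every $\beta\in[\beta^*,0)$, and $\lim_{c\to u_{\max}^+}\lambda_1(c)=-\infty$ for every $\beta\in[\tfrac98\kappa_-,\beta^*)$. 3. If $u(y)\ne u_{\min}$ for all $y\in(y_1,y_2)$, then $\inf_{c<u_{\min}}\lambda_1(c)>-\infty$ for every real $\beta$ with $0<\beta\le\tfrac98\kappa_+$ (every $\beta>0$ if $\kappa_+=+\infty$).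 4. If $u(y)\ne u_{\max}$ for all $y\in(y_1,y_2)$, then $\inf_{c>u_{\max}}\lambda_1(c)>-\infty$ for every real $\beta$ with $\tfrac98\kappa_-\le\beta<0$ (every $\beta<0$ if $\kappa_-=-\infty$). -/

import Mathlib

open Set Filter Topology MeasureTheory
open scoped ContDiff

namespace RayleighKuo

noncomputable section

/-- `g` is the weak derivative of order `k` of `f` on the open interval `(a, b)`. -/
def IsWeakDeriv (k : ℕ) (a b : ℝ) (f g : ℝ → ℝ) : Prop :=
  ∀ η : ℝ → ℝ, ContDiff ℝ ∞ η → HasCompactSupport η → tsupport η ⊆ Ioo a b →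
    ∫ y in Ioo a b, f y * iteratedDeriv k η y = (-1) ^ k * ∫ y in Ioo a b, g y * η y

/-- Square integrability on `(a, b)`. -/
def MemL2 (a b : ℝ) (f : ℝ → ℝ) : Prop :=
  MemLp f 2 (volume.restrict (Ioo a b))

/-- The Sobolev space `H^k(a, b)`: `f` and its weak derivatives up to order `k` are
square integrable. -/
def MemH (k : ℕ) (a b : ℝ) (f : ℝ → ℝ) : Prop :=
  MemL2 a b f ∧ ∀ j ≤ k, ∃ g : ℝ → ℝ, MemL2 a b g ∧ IsWeakDeriv j a b f g

/-- First derivative of `u` on the closed interval, one-sided at the endpoints. -/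
def d1 (y₁ y₂ : ℝ) (u : ℝ → ℝ) (y : ℝ) : ℝ := derivWithin u (Icc y₁ y₂) y

/-- Second derivative of `u` on the closed interval, one-sided at the endpoints. -/
def d2 (y₁ y₂ : ℝ) (u : ℝ → ℝ) (y : ℝ) : ℝ := iteratedDerivWithin 2 u (Icc y₁ y₂) y

/-- The standing assumption on the flow: `u` belongs to `H^4(y₁, y₂)` (it is taken to be the
continuous representative, which is then three times continuously differentiable on `[y₁, y₂]`)
and `u''` does not vanish at any critical point of `u` in `[y₁, y₂]`. -/
structure H1 (y₁ y₂ : ℝ) (u : ℝ → ℝ) : Prop where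
  continuousOn : ContinuousOn u (Icc y₁ y₂)
  memH : MemH 4 y₁ y₂ u
  nondegenerate : ∀ y ∈ Icc y₁ y₂, d1 y₁ y₂ u y = 0 → d2 y₁ y₂ u y ≠ 0

/-- The minimum of `u` over `[y₁, y₂]`. -/
def uMin (y₁ y₂ : ℝ) (u : ℝ → ℝ) : ℝ := sInf (u '' Icc y₁ y₂)

/-- The maximum of `u` over `[y₁, y₂]`. -/
def uMax (y₁ y₂ : ℝ) (u : ℝ → ℝ) : ℝ := sSup (u '' Icc y₁ y₂)

/-- The smallest value of `u''` at the critical points in `[y₁, y₂]` where `u` is minimal;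
it is `+∞` if there is no such point. -/
def kappaPlus (y₁ y₂ : ℝ) (u : ℝ → ℝ) : EReal :=
  sInf ((fun y => (d2 y₁ y₂ u y : EReal)) ''
    {y | y ∈ Icc y₁ y₂ ∧ d1 y₁ y₂ u y = 0 ∧ u y = uMin y₁ y₂ u})

/-- The largest value of `u''` at the critical points in `[y₁, y₂]` where `u` is maximal;
it is `-∞` if there is no such point. -/
def kappaMinus (y₁ y₂ : ℝ) (u : ℝ → ℝ) : EReal :=
  sSup ((fun y => (d2 y₁ y₂ u y : EReal)) ''
    {y | y ∈ Icc y₁ y₂ ∧ d1 y₁ y₂ u y = 0 ∧ u y = uMax y₁ y₂ u})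

/-- The smallest value of `u''` at the interior points where `u` is minimal. -/
def muPlus (y₁ y₂ : ℝ) (u : ℝ → ℝ) : EReal :=
  sInf ((fun y => (d2 y₁ y₂ u y : EReal)) '' {y | y ∈ Ioo y₁ y₂ ∧ u y = uMin y₁ y₂ u})

/-- The largest value of `u''` at the interior points where `u` is maximal. -/
def muMinus (y₁ y₂ : ℝ) (u : ℝ → ℝ) : EReal :=
  sSup ((fun y => (d2 y₁ y₂ u y : EReal)) '' {y | y ∈ Ioo y₁ y₂ ∧ u y = uMax y₁ y₂ u})

/-- `lam` is an eigenvalue of the Rayleigh-Kuo boundary value problem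
`-φ'' + (u'' - β) / (u - c) φ = lam φ`, `φ(y₁) = φ(y₂) = 0`, with a nonzero eigenfunction in
`H^1_0 ∩ H^2` (given by its continuous representative). -/
def IsEigenvalue (y₁ y₂ : ℝ) (u : ℝ → ℝ) (β c lam : ℝ) : Prop :=
  ∃ φ φ'' : ℝ → ℝ,
    ContinuousOn φ (Icc y₁ y₂) ∧ MemH 2 y₁ y₂ φ ∧ φ y₁ = 0 ∧ φ y₂ = 0 ∧
    (∃ y ∈ Icc y₁ y₂, φ y ≠ 0) ∧
    MemL2 y₁ y₂ φ'' ∧ IsWeakDeriv 2 y₁ y₂ φ φ'' ∧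
    ∀ᵐ y ∂(volume.restrict (Ioo y₁ y₂)),
      -φ'' y + (d2 y₁ y₂ u y - β) / (u y - c) * φ y = lam * φ y

/-- The first (smallest) eigenvalue of the Rayleigh-Kuo boundary value problem. -/
def lambda1 (y₁ y₂ : ℝ) (u : ℝ → ℝ) (β c : ℝ) : ℝ :=
  sInf {lam | IsEigenvalue y₁ y₂ u β c lam}

end

end RayleighKuo

/-! ### Weak derivatives, du Bois-Reymond, and regularity of the flow. -/

namespace RayleighKuo

/-! The first eigenvalue is the minimum of the Rayleigh quotient of `∫ φ'² + q φ²` with `q = (u'' -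
β) / (u - c)`. So a uniform bound on `lambda1` is a bound of these forms uniform in `c`
(`FormBound`), while a single test function whose form tends to `-∞` forces `lambda1` to `-∞`
(`lambda1_spec`).

Forms add over subintervals, so the bound is a local question (`FormBound.of_local`), and only
points `y₀` with `u y₀ = u_min` matter. Write `x = |y - y₀|` and `κ = u''(y₀)`.

At an endpoint, `φ` vanishes. If `u'(y₀) ≠ 0`, then `q ≥ -K / x`. If `u'(y₀) = 0`, then `u - c ≥ u -
u_min ≈ κ x² / 2`, and `β ≤ 9κ/8` gives `q ≥ -1 / (4 x²)` up to `O(1 / x)`: the number 9/8 is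
exactly what the Hardy constant 1/4 allows (`Profile.hardy_le_potential`,
`FormBound.of_hardy_left`).

At an interior point `φ` need not vanish, and the requirement becomes `β ≤ κ`. Then `u'' - β` is at
least its linear Taylor term minus `O(x^(3/2))`, because `u'''` is 1/2-Hölder for `u ∈ H⁴`. The
linear term equals `A u'` up to `O(x²)` with `A = u'''(y₀) / κ`, so `q ≥ A (log (u - c))' - K / √x`.
The primitive `A log (u - c)` has a square dominated by an integrable function uniformly in `c`,
which a Riccati argument turns into a bound (`FormBound.of_log_deriv`). If instead `β > κ`, a bump
at `y₀` sees a potential of size `-1 / (u_min - c)` on a window of width `√(u_min - c)`, and its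
form diverges (`Profile.exists_form_tendsto_atBot`).

All lower bounds come from one inequality: `w' + w² ≤ p` bounds `∫ φ'² + p φ²` below by the boundary
terms of `w φ²` (`riccati_le_integral`). With `w` the logarithmic derivative of a positive solution
it also gives the variational principle, the positive solution being found by shooting
(`exists_first_eigenvalue`). Maxima reduce to minima, since `q` is unchanged when `u`, `β` and `c`
all change sign. -/

theorem exists_Icc_of_isCompact_subset_Ioo {a b : ℝ} (hab : a < b) {K : Set ℝ} (hK : IsCompact K)
    (h : K ⊆ Ioo a b) : ∃ c d, a < c ∧ c ≤ d ∧ d < b ∧ K ⊆ Icc c d := by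
  rcases K.eq_empty_or_nonempty with rfl | hne
  · exact ⟨(a + b) / 2, (a + b) / 2, by linarith, le_rfl, by linarith, empty_subset _⟩
  · obtain ⟨c, hc⟩ := hK.exists_isLeast hne
    obtain ⟨d, hd⟩ := hK.exists_isGreatest hne
    exact ⟨c, d, (h hc.1).1, hc.2 hd.1, (h hd.1).2, fun x hx => ⟨hc.2 hx, hd.2 hx⟩⟩

/-- A smooth compactly supported function with zero integral has a compactly supported
primitive. -/
theorem exists_primitive_of_integral_eq_zero {a b : ℝ} (hab : a < b) {p : ℝ → ℝ}
    (hp : ContDiff ℝ ∞ p) (hc : HasCompactSupport p) (hs : tsupport p ⊆ Ioo a b)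
    (h0 : ∫ y in a..b, p y = 0) :
    ∃ η : ℝ → ℝ, ContDiff ℝ ∞ η ∧ HasCompactSupport η ∧ tsupport η ⊆ Ioo a b ∧ deriv η = p := by
  obtain ⟨c, d, hac, hcd, hdb, hK⟩ := exists_Icc_of_isCompact_subset_Ioo hab hc hs
  have hpc : Continuous p := hp.continuous
  have hint : ∀ x y, IntervalIntegrable p volume x y := fun x y => hpc.intervalIntegrable x y
  have hz : ∀ y, y ∉ Icc c d → p y = 0 := fun y hy => by
    by_contra hne
    exact hy (hK (subset_tsupport _ hne))
  have hder : ∀ y, HasDerivAt (fun y => ∫ t in a..y, p t) (p y) y := fun y =>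
    intervalIntegral.integral_hasDerivAt_right (hint _ _)
      (hpc.stronglyMeasurableAtFilter _ _) hpc.continuousAt
  have hderiv : deriv (fun y => ∫ t in a..y, p t) = p := funext fun y => (hder y).deriv
  have hsub : Function.support (fun y => ∫ t in a..y, p t) ⊆ Icc c d := by
    intro y hy
    by_contra hy'
    apply hy
    simp only [mem_Icc, not_and_or, not_le] at hy'
    rcases hy' with hy' | hy'
    · refine (intervalIntegral.integral_congr (g := fun _ => (0 : ℝ)) fun t ht => ?_).trans (by simp)
      refine hz t fun ht' => ?_
      have := ht.2
      have := max_lt hac hy'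
      linarith [ht'.1]
    · change ∫ t in a..y, p t = 0
      rw [← intervalIntegral.integral_add_adjacent_intervals (hint a b) (hint b y), h0, zero_add]
      refine (intervalIntegral.integral_congr (g := fun _ => (0 : ℝ)) fun t ht => ?_).trans (by simp)
      refine hz t fun ht' => ?_
      have := ht.1
      have := lt_min hdb hy'
      linarith [ht'.2]
  have hts : tsupport (fun y => ∫ t in a..y, p t) ⊆ Icc c d :=
    closure_minimal hsub isClosed_Icc
  refine ⟨_, ?_, ?_, hts.trans (fun x hx => ⟨hac.trans_le hx.1, hx.2.trans_lt hdb⟩), hderiv⟩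
  · rw [contDiff_infty_iff_deriv, hderiv]
    exact ⟨fun y => (hder y).differentiableAt, hp⟩
  · exact isCompact_Icc.of_isClosed_subset (isClosed_tsupport _) hts

theorem exists_test_integral_eq_one {a b : ℝ} (hab : a < b) :
    ∃ θ : ℝ → ℝ, ContDiff ℝ ∞ θ ∧ HasCompactSupport θ ∧ tsupport θ ⊆ Ioo a b ∧
      ∫ y in a..b, θ y = 1 := by
  let f : ContDiffBump ((a + b) / 2) := ⟨(b - a) / 8, (b - a) / 4, by linarith, by linarith⟩
  have hts : tsupport (f.normed volume) ⊆ Ioo a b := by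
    rw [f.tsupport_normed_eq, Real.closedBall_eq_Icc]
    intro x hx
    simp only [f, mem_Icc] at hx
    exact ⟨by linarith [hx.1], by linarith [hx.2]⟩
  refine ⟨f.normed volume, f.contDiff_normed, f.hasCompactSupport_normed, hts, ?_⟩
  rw [intervalIntegral.integral_of_le hab.le, setIntegral_eq_integral_of_forall_compl_eq_zero,
    f.integral_normed]
  intro x hx
  by_contra hne
  exact hx (Ioo_subset_Ioc_self (hts (subset_tsupport _ hne)))

/-- The lemma of du Bois-Reymond. -/
theorem ae_eq_const_of_integral_mul_deriv_eq_zero {a b : ℝ} (hab : a < b) {f : ℝ → ℝ}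
    (hf : IntegrableOn f (Ioo a b))
    (h : ∀ η : ℝ → ℝ, ContDiff ℝ ∞ η → HasCompactSupport η → tsupport η ⊆ Ioo a b →
      ∫ y in Ioo a b, f y * deriv η y = 0) :
    ∃ k : ℝ, ∀ᵐ y ∂(volume.restrict (Ioo a b)), f y = k := by
  obtain ⟨θ, hθ, hθc, hθs, hθ1⟩ := exists_test_integral_eq_one hab
  set k := ∫ y in Ioo a b, f y * θ y with hk
  refine ⟨k, ?_⟩
  have hmul : ∀ η : ℝ → ℝ, Continuous η → HasCompactSupport η →
      IntegrableOn (fun y => f y * η y) (Ioo a b) := fun η hη hc => by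
    obtain ⟨C, hC⟩ := hη.bounded_above_of_compact_support hc
    exact hf.mul_bdd (c := C) hη.aestronglyMeasurable (ae_of_all _ hC)
  rw [ae_restrict_iff' measurableSet_Ioo]
  have key := isOpen_Ioo.ae_eq_zero_of_integral_contDiff_smul_eq_zero (U := Ioo a b)
    (f := fun y => f y - k) (μ := volume) ?_ ?_
  · filter_upwards [key] with y hy hy'
    linarith [hy hy']
  · exact (hf.sub (integrableOn_const (by simp))).locallyIntegrableOn
  · intro ψ hψ hψc hψs
    -- Subtracting the multiple of `θ` with the same integral leaves a test function of zero
    -- integral, hence the derivative of a test function, to which `h` applies.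
    have hsm : ContDiff ℝ ∞ (fun y => ψ y - (∫ t in a..b, ψ t) * θ y) :=
      hψ.sub (contDiff_const.mul hθ)
    have hcs : HasCompactSupport (fun y => ψ y - (∫ t in a..b, ψ t) * θ y) :=
      hψc.sub (hθc.mul_left (f := fun _ => ∫ t in a..b, ψ t))
    have hts : tsupport (fun y => ψ y - (∫ t in a..b, ψ t) * θ y) ⊆ Ioo a b := by
      refine (closure_minimal (t := tsupport ψ ∪ tsupport θ) (fun y hy => ?_)
        ((isClosed_tsupport _).union (isClosed_tsupport _))).trans (union_subset hψs hθs)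
      by_contra hne
      simp only [mem_union, not_or] at hne
      apply hy
      simp [image_eq_zero_of_notMem_tsupport hne.1, image_eq_zero_of_notMem_tsupport hne.2]
    obtain ⟨η, hη, hηc, hηs, hd⟩ := exists_primitive_of_integral_eq_zero hab hsm hcs hts (by
      rw [intervalIntegral.integral_sub (hψ.continuous.intervalIntegrable _ _)
        ((hθ.continuous.intervalIntegrable _ _).const_mul _),
        intervalIntegral.integral_const_mul, hθ1]
      ring)
    have h0 := h η hη hηc hηs
    rw [hd] at h0
    have e1 : ∫ y in Ioo a b, f y * (ψ y - (∫ t in a..b, ψ t) * θ y) =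
        (∫ y in Ioo a b, f y * ψ y) - (∫ t in a..b, ψ t) * k := by
      rw [hk, ← integral_const_mul, ← integral_sub (hmul ψ hψ.continuous hψc)
        ((hmul θ hθ.continuous hθc).const_mul _)]
      congr 1; ext y; ring
    rw [e1] at h0
    have e2 : ∫ y, ψ y • (f y - k) = ∫ y in Ioo a b, ψ y • (f y - k) := by
      rw [setIntegral_eq_integral_of_forall_compl_eq_zero]
      intro y hy
      rw [image_eq_zero_of_notMem_tsupport (fun h' => hy (hψs h')), zero_smul]
    have e3 : ∫ y in Ioo a b, ψ y • (f y - k) =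
        (∫ y in Ioo a b, f y * ψ y) - k * ∫ y in Ioo a b, ψ y := by
      rw [← integral_const_mul, ← integral_sub (hmul ψ hψ.continuous hψc)
        ((hψ.continuous.integrable_of_hasCompactSupport hψc).integrableOn.const_mul _)]
      congr 1; ext y; simp only [smul_eq_mul]; ring
    rw [e2, e3, ← integral_Ioc_eq_integral_Ioo (f := ψ), ← intervalIntegral.integral_of_le hab.le]
    linarith

/-- Integration by parts for a primitive of an integrable function against a test function. -/
theorem integral_primitive_mul_deriv {a b : ℝ} (hab : a < b) {g : ℝ → ℝ}
    (hg : IntegrableOn g (Ioo a b)) {η : ℝ → ℝ} (hη : ContDiff ℝ ∞ η)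
    (hs : tsupport η ⊆ Ioo a b) :
    ∫ y in Ioo a b, (∫ t in a..y, g t) * deriv η y = - ∫ y in Ioo a b, g y * η y := by
  have hgi : IntervalIntegrable g volume a b :=
    (intervalIntegrable_iff_integrableOn_Ioo_of_le hab.le).2 hg
  have hG := hgi.absolutelyContinuousOnInterval_intervalIntegral (c := a) (by simp)
  have hηac : AbsolutelyContinuousOnInterval η a b :=
    ((hη.of_le (by norm_cast)).contDiffOn (n := 1)).absolutelyContinuousOnInterval
  have hηa : η a = 0 := image_eq_zero_of_notMem_tsupport fun h => (hs h).1.false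
  have hηb : η b = 0 := image_eq_zero_of_notMem_tsupport fun h => (hs h).2.false
  have key := hG.integral_mul_deriv_eq_deriv_mul hηac
  rw [hηa, hηb, mul_zero, mul_zero, sub_zero, zero_sub] at key
  rw [← integral_Ioc_eq_integral_Ioo, ← integral_Ioc_eq_integral_Ioo,
    ← intervalIntegral.integral_of_le hab.le, ← intervalIntegral.integral_of_le hab.le, key]
  congr 1
  refine intervalIntegral.integral_congr_ae ?_
  filter_upwards [hgi.ae_hasDerivAt_integral] with x hx hx'
  rw [(hx (uIoc_subset_uIcc hx') a (by simp)).deriv]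

/-- The difference of `f` and a primitive of `g` annihilates all derivatives of test functions, so
du Bois-Reymond makes it constant. -/
theorem IsWeakDeriv.ae_eq_primitive {a b : ℝ} (hab : a < b) {f g : ℝ → ℝ}
    (hf : IntegrableOn f (Ioo a b)) (hg : IntegrableOn g (Ioo a b)) (h : IsWeakDeriv 1 a b f g) :
    ∃ k : ℝ, ∀ᵐ y ∂(volume.restrict (Ioo a b)), f y = k + ∫ t in a..y, g t := by
  have hgi : IntervalIntegrable g volume a b :=
    (intervalIntegrable_iff_integrableOn_Ioo_of_le hab.le).2 hg
  have hGc : ContinuousOn (fun y => ∫ t in a..y, g t) (Icc a b) := by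
    have := (hgi.absolutelyContinuousOnInterval_intervalIntegral (c := a) (by simp)).continuousOn
    rwa [uIcc_of_le hab.le] at this
  have hGi : IntegrableOn (fun y => ∫ t in a..y, g t) (Ioo a b) :=
    (hGc.integrableOn_Icc).mono_set Ioo_subset_Icc_self
  obtain ⟨k, hk⟩ := ae_eq_const_of_integral_mul_deriv_eq_zero hab (hf.sub hGi) (by
    intro η hη hc hs
    obtain ⟨C, hC⟩ := (hη.continuous_deriv (by norm_cast)).bounded_above_of_compact_support hc.deriv
    have hm : AEStronglyMeasurable (deriv η) (volume.restrict (Ioo a b)) :=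
      (hη.continuous_deriv (by norm_cast)).aestronglyMeasurable
    have h1 := h η hη hc hs
    simp only [iteratedDeriv_one, pow_one] at h1
    have h2 := integral_primitive_mul_deriv hab hg hη hs
    simp only [Pi.sub_apply, sub_mul]
    rw [integral_sub (hf.mul_bdd hm (ae_of_all _ hC)) (hGi.mul_bdd hm (ae_of_all _ hC)), h1, h2]
    ring)
  refine ⟨k, hk.mono fun y hy => ?_⟩
  simp only [Pi.sub_apply] at hy
  linarith

theorem MemL2.integrableOn {a b : ℝ} {f : ℝ → ℝ} (h : MemL2 a b f) : IntegrableOn f (Ioo a b) :=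
  MemLp.integrable (by norm_num) h

/-- If `η` is a test function, so is `η'`; inserting it in the identity of order `k` and cancelling
`(-1) ^ k` relates consecutive weak derivatives. The derivatives can then be integrated back one at
a time. -/
theorem IsWeakDeriv.one_of_succ {k : ℕ} {a b : ℝ} {f g g' : ℝ → ℝ} (h : IsWeakDeriv k a b f g)
    (h' : IsWeakDeriv (k + 1) a b f g') : IsWeakDeriv 1 a b g g' := by
  intro η hη hc hs
  have e1 := h (deriv η) (by
    have := (contDiff_infty_iff_deriv.1 hη).2
    exact this) hc.deriv ((tsupport_deriv_subset).trans hs)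
  have e2 := h' η hη hc hs
  rw [iteratedDeriv_succ', e1, pow_succ, mul_assoc] at e2
  have h1 : ((-1 : ℝ)) ^ k ≠ 0 := by positivity
  rw [iteratedDeriv_one, pow_one]
  exact mul_left_cancel₀ h1 e2

theorem hasDerivAt_primitive {g : ℝ → ℝ} (hg : Continuous g) (k a y : ℝ) :
    HasDerivAt (fun y => k + ∫ t in a..y, g t) (g y) y :=
  (intervalIntegral.integral_hasDerivAt_right (hg.intervalIntegrable _ _)
    (hg.stronglyMeasurableAtFilter _ _) hg.continuousAt).const_add k

theorem primitive_congr_ae {a b : ℝ} {f g : ℝ → ℝ} (h : ∀ᵐ y ∂(volume.restrict (Ioo a b)), f y = g y)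
    {y : ℝ} (hy : y ∈ Icc a b) : ∫ t in a..y, f t = ∫ t in a..y, g t := by
  rw [ae_restrict_iff' measurableSet_Ioo] at h
  refine intervalIntegral.integral_congr_ae ?_
  filter_upwards [h, compl_mem_ae_iff.2 (measure_singleton b)] with x hx hxb hx'
  rw [uIoc_of_le hy.1] at hx'
  exact hx ⟨hx'.1, lt_of_le_of_ne (hx'.2.trans hy.2) hxb⟩

theorem eqOn_Icc_of_ae_eq {a b : ℝ} (hab : a < b) {f g : ℝ → ℝ} (hf : ContinuousOn f (Icc a b))
    (hg : ContinuousOn g (Icc a b)) (h : ∀ᵐ y ∂(volume.restrict (Ioo a b)), f y = g y) :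
    EqOn f g (Icc a b) := by
  refine Measure.eqOn_Icc_of_ae_eq (μ := volume) hab.ne ?_ hf hg
  rw [restrict_Ioo_eq_restrict_Icc] at h
  exact h

/-- A form of Cauchy-Schwarz: with `s = √(y - x)`, integrate `|g| ≤ s⁻¹ + s g²` over an interval of
length `s²`. It yields the Hölder exponent 1/2 of the third derivative. -/
theorem abs_integral_le_sqrt_mul {a b : ℝ} {g : ℝ → ℝ} (hg : MemL2 a b g) {x y : ℝ} (hx : a ≤ x)
    (hxy : x ≤ y) (hy : y ≤ b) :
    |∫ t in x..y, g t| ≤ (1 + ∫ t in Ioo a b, g t ^ 2) * √(y - x) := by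
  rcases hxy.eq_or_lt with rfl | hlt
  · simp
  have hsq : IntegrableOn (fun t => g t ^ 2) (Ioo a b) := MemLp.integrable_sq hg
  have hsub : Ioo x y ⊆ Ioo a b := Ioo_subset_Ioo hx hy
  have hs : 0 < √(y - x) := Real.sqrt_pos.2 (by linarith)
  set s := √(y - x) with hsdef
  have hss : s * s = y - x := Real.mul_self_sqrt (by linarith)
  rw [intervalIntegral.integral_of_le hxy, integral_Ioc_eq_integral_Ioo]
  have h1 : |∫ t in Ioo x y, g t| ≤ ∫ t in Ioo x y, |g t| := abs_integral_le_integral_abs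
  have h2 : ∫ t in Ioo x y, |g t| ≤ ∫ t in Ioo x y, (s⁻¹ + s * g t ^ 2) := by
    refine integral_mono ((hg.integrableOn.mono_set hsub).abs)
      ((integrableOn_const (by simp)).add ((hsq.mono_set hsub).const_mul s)) fun t => ?_
    have : s⁻¹ * s = 1 := inv_mul_cancel₀ hs.ne'
    have hi : 0 < s⁻¹ := inv_pos.2 hs
    simp only
    have h3 : 0 ≤ s⁻¹ * ((1 - s * |g t|) ^ 2) := by positivity
    have h4 : s⁻¹ * ((1 - s * |g t|) ^ 2) = s⁻¹ - 2 * |g t| + s * g t ^ 2 := by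
      rw [← sq_abs (g t)]; field_simp; ring
    have := abs_nonneg (g t)
    linarith
  have h3 : ∫ t in Ioo x y, (s⁻¹ + s * g t ^ 2) = s + s * ∫ t in Ioo x y, g t ^ 2 := by
    rw [integral_add (integrable_const _) ((hsq.mono_set hsub).const_mul s),
      integral_const_mul]
    congr 1
    rw [setIntegral_const]
    simp only [measureReal_def, Real.volume_Ioo, smul_eq_mul]
    rw [ENNReal.toReal_ofReal (by linarith), ← hss]
    field_simp
  have h4 : ∫ t in Ioo x y, g t ^ 2 ≤ ∫ t in Ioo a b, g t ^ 2 :=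
    setIntegral_mono_set hsq (ae_of_all _ fun t => sq_nonneg _) (LE.le.eventuallyLE hsub)
  nlinarith

/-- A `C³` profile on the line whose third derivative is `1/2`-Hölder on `[a, b]`, with
nondegenerate critical points in `[a, b]`. -/
structure Profile (a b : ℝ) (U U₁ U₂ U₃ : ℝ → ℝ) : Prop where
  hasDerivAt₀ : ∀ y, HasDerivAt U (U₁ y) y
  hasDerivAt₁ : ∀ y, HasDerivAt U₁ (U₂ y) y
  hasDerivAt₂ : ∀ y, HasDerivAt U₂ (U₃ y) y
  continuous₃ : Continuous U₃
  holder : ∃ C, ∀ x ∈ Icc a b, ∀ y ∈ Icc a b, |U₃ y - U₃ x| ≤ C * √|y - x|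
  nondegenerate : ∀ y ∈ Icc a b, U₁ y = 0 → U₂ y ≠ 0

/-- Four successive integrations, starting from the fourth weak derivative, rebuild `u` almost
everywhere, and everywhere on the closed interval by continuity. The result lives on the whole line,
so one-sided derivatives are no longer needed. -/
theorem H1.exists_profile {a b : ℝ} (hab : a < b) {u : ℝ → ℝ} (hu : H1 a b u) :
    ∃ U U₁ U₂ U₃ : ℝ → ℝ, Profile a b U U₁ U₂ U₃ ∧ EqOn u U (Icc a b) ∧
      EqOn (d1 a b u) U₁ (Icc a b) ∧ EqOn (d2 a b u) U₂ (Icc a b) := by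
  obtain ⟨g₁, h₁, w₁⟩ := hu.memH.2 1 (by norm_num)
  obtain ⟨g₂, h₂, w₂⟩ := hu.memH.2 2 (by norm_num)
  obtain ⟨g₃, h₃, w₃⟩ := hu.memH.2 3 (by norm_num)
  obtain ⟨g₄, h₄, w₄⟩ := hu.memH.2 4 (by norm_num)
  obtain ⟨k₀, e₀⟩ := w₁.ae_eq_primitive hab hu.memH.1.integrableOn h₁.integrableOn
  obtain ⟨k₁, e₁⟩ := (w₁.one_of_succ w₂).ae_eq_primitive hab h₁.integrableOn h₂.integrableOn
  obtain ⟨k₂, e₂⟩ := (w₂.one_of_succ w₃).ae_eq_primitive hab h₂.integrableOn h₃.integrableOn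
  obtain ⟨k₃, e₃⟩ := (w₃.one_of_succ w₄).ae_eq_primitive hab h₃.integrableOn h₄.integrableOn
  -- Cutting off outside the interval makes the integrand integrable on the line, so that all
  -- primitives are defined globally.
  let G : ℝ → ℝ := (Ioo a b).indicator g₄
  have hGi : Integrable G := (integrable_indicator_iff measurableSet_Ioo).2 h₄.integrableOn
  have hG : ∀ᵐ y ∂(volume.restrict (Ioo a b)), g₄ y = G y := by
    rw [ae_restrict_iff' measurableSet_Ioo]
    exact ae_of_all _ fun y hy => (indicator_of_mem hy _).symm
  have hIoo : ∀ᵐ y ∂(volume.restrict (Ioo a b)), y ∈ Icc a b := by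
    rw [ae_restrict_iff' measurableSet_Ioo]
    exact ae_of_all _ fun y hy => Ioo_subset_Icc_self hy
  let U₃ : ℝ → ℝ := fun y => k₃ + ∫ t in a..y, G t
  let U₂ : ℝ → ℝ := fun y => k₂ + ∫ t in a..y, U₃ t
  let U₁ : ℝ → ℝ := fun y => k₁ + ∫ t in a..y, U₂ t
  let U : ℝ → ℝ := fun y => k₀ + ∫ t in a..y, U₁ t
  have c₃ : Continuous U₃ := continuous_const.add
    (intervalIntegral.continuous_primitive (fun _ _ => hGi.intervalIntegrable) a)
  have D₂ : ∀ y, HasDerivAt U₂ (U₃ y) y := hasDerivAt_primitive c₃ k₂ a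
  have c₂ : Continuous U₂ := continuous_iff_continuousAt.2 fun y => (D₂ y).continuousAt
  have D₁ : ∀ y, HasDerivAt U₁ (U₂ y) y := hasDerivAt_primitive c₂ k₁ a
  have c₁ : Continuous U₁ := continuous_iff_continuousAt.2 fun y => (D₁ y).continuousAt
  have D₀ : ∀ y, HasDerivAt U (U₁ y) y := hasDerivAt_primitive c₁ k₀ a
  have c₀ : Continuous U := continuous_iff_continuousAt.2 fun y => (D₀ y).continuousAt
  have E₃ : ∀ᵐ y ∂(volume.restrict (Ioo a b)), g₃ y = U₃ y := by
    filter_upwards [e₃, hIoo] with y hy hy'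
    rw [hy, primitive_congr_ae hG hy']
  have E₂ : ∀ᵐ y ∂(volume.restrict (Ioo a b)), g₂ y = U₂ y := by
    filter_upwards [e₂, hIoo] with y hy hy'
    rw [hy, primitive_congr_ae E₃ hy']
  have E₁ : ∀ᵐ y ∂(volume.restrict (Ioo a b)), g₁ y = U₁ y := by
    filter_upwards [e₁, hIoo] with y hy hy'
    rw [hy, primitive_congr_ae E₂ hy']
  have E₀ : ∀ᵐ y ∂(volume.restrict (Ioo a b)), u y = U y := by
    filter_upwards [e₀, hIoo] with y hy hy'
    rw [hy, primitive_congr_ae E₁ hy']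
  have hEq : EqOn u U (Icc a b) := eqOn_Icc_of_ae_eq hab hu.continuousOn c₀.continuousOn E₀
  have hud : UniqueDiffOn ℝ (Icc a b) := uniqueDiffOn_Icc hab
  have hd1 : EqOn (d1 a b u) U₁ (Icc a b) := fun y hy =>
    (derivWithin_congr hEq (hEq hy)).trans ((D₀ y).hasDerivWithinAt.derivWithin (hud y hy))
  have hd2 : EqOn (d2 a b u) U₂ (Icc a b) := fun y hy => by
    change iteratedDerivWithin 2 u (Icc a b) y = _
    rw [iteratedDerivWithin_succ, derivWithin_congr (f := U₁) _ _]
    · exact (D₁ y).hasDerivWithinAt.derivWithin (hud y hy)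
    · intro z hz
      rw [iteratedDerivWithin_one]
      exact hd1 hz
    · rw [iteratedDerivWithin_one]
      exact hd1 hy
  refine ⟨U, U₁, U₂, U₃, ⟨D₀, D₁, D₂, c₃, ⟨1 + ∫ t in Ioo a b, g₄ t ^ 2, ?_⟩, ?_⟩, hEq, hd1, hd2⟩
  · have main : ∀ x ∈ Icc a b, ∀ y ∈ Icc a b, x ≤ y →
        |U₃ y - U₃ x| ≤ (1 + ∫ t in Ioo a b, g₄ t ^ 2) * √|y - x| := by
      intro x hx y hy hxy
      have : U₃ y - U₃ x = ∫ t in x..y, g₄ t := by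
        simp only [U₃]
        rw [add_sub_add_left_eq_sub, intervalIntegral.integral_interval_sub_left
          hGi.intervalIntegrable hGi.intervalIntegrable, intervalIntegral.integral_of_le hxy,
          intervalIntegral.integral_of_le hxy, integral_Ioc_eq_integral_Ioo,
          integral_Ioc_eq_integral_Ioo]
        exact setIntegral_congr_fun measurableSet_Ioo fun t ht =>
          indicator_of_mem (Ioo_subset_Ioo hx.1 hy.2 ht) _
      rw [this, abs_of_nonneg (sub_nonneg.2 hxy)]
      exact abs_integral_le_sqrt_mul h₄ hx.1 hxy hy.2
    intro x hx y hy
    rcases le_total x y with h | h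
    · exact main x hx y hy h
    · rw [abs_sub_comm, abs_sub_comm y x]
      exact main y hy x hx h
  · intro y hy h0
    rw [← hd2 hy]
    exact hu.nondegenerate y hy ((hd1 hy).trans h0)

/-! ### Weak and classical eigenvalues. -/

/-- A classical eigenvalue of `-φ'' + q φ = lam φ`, `φ(a) = φ(b) = 0`. -/
def IsClassicalEigenvalue (a b : ℝ) (q : ℝ → ℝ) (lam : ℝ) : Prop :=
  ∃ φ φ₁ φ₂ : ℝ → ℝ, (∀ y, HasDerivAt φ (φ₁ y) y) ∧ (∀ y, HasDerivAt φ₁ (φ₂ y) y) ∧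
    Continuous φ₂ ∧ (∀ y ∈ Icc a b, φ₂ y = (q y - lam) * φ y) ∧ φ a = 0 ∧ φ b = 0 ∧
    ∃ y ∈ Icc a b, φ y ≠ 0

theorem memL2_of_continuous {a b : ℝ} {f : ℝ → ℝ} (hf : Continuous f) : MemL2 a b f := by
  obtain ⟨C, hC⟩ := isCompact_Icc.exists_bound_of_continuousOn (s := Icc a b) hf.continuousOn
  refine MemLp.of_bound hf.aestronglyMeasurable C ?_
  rw [ae_restrict_iff' measurableSet_Ioo]
  exact ae_of_all _ fun y hy => hC y (Ioo_subset_Icc_self hy)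

theorem integral_mul_deriv_test {a b : ℝ} (hab : a < b) {f f' : ℝ → ℝ}
    (hf : ∀ y, HasDerivAt f (f' y) y) (hf' : Continuous f') {η : ℝ → ℝ} (hη : ContDiff ℝ ∞ η)
    (hs : tsupport η ⊆ Ioo a b) :
    ∫ y in Ioo a b, f y * deriv η y = - ∫ y in Ioo a b, f' y * η y := by
  have hηa : η a = 0 := image_eq_zero_of_notMem_tsupport fun h => (hs h).1.false
  have hηb : η b = 0 := image_eq_zero_of_notMem_tsupport fun h => (hs h).2.false
  have hd := contDiff_infty_iff_deriv.1 hη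
  have key := intervalIntegral.integral_mul_deriv_eq_deriv_mul (a := a) (b := b) (u := f) (v := η)
    (fun y _ => hf y) (fun y _ => (hd.1 y).hasDerivAt) (hf'.intervalIntegrable _ _)
    (hd.2.continuous.intervalIntegrable _ _)
  rw [hηa, hηb, mul_zero, mul_zero, sub_zero, zero_sub] at key
  rw [← integral_Ioc_eq_integral_Ioo, ← integral_Ioc_eq_integral_Ioo,
    ← intervalIntegral.integral_of_le hab.le, ← intervalIntegral.integral_of_le hab.le, key]

/-- Elliptic regularity in one dimension: the equation equates the weak `φ''` almost everywhere with
a continuous function, so integrating twice gives a C² representative. The converse is integration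
by parts. -/
theorem isEigenvalue_iff_isClassicalEigenvalue {a b : ℝ} (hab : a < b) {u : ℝ → ℝ} {β c lam : ℝ}
    (hq : ContinuousOn (fun y => (d2 a b u y - β) / (u y - c)) (Icc a b)) :
    IsEigenvalue a b u β c lam ↔
      IsClassicalEigenvalue a b (fun y => (d2 a b u y - β) / (u y - c)) lam := by
  constructor
  · rintro ⟨φ, φ₂, hc, hH, ha, hb, hne, h₂, w₂, heq⟩
    obtain ⟨g₁, h₁, w₁⟩ := hH.2 1 (by norm_num)
    obtain ⟨k₀, e₀⟩ := w₁.ae_eq_primitive hab hH.1.integrableOn h₁.integrableOn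
    obtain ⟨k₁, e₁⟩ := (w₁.one_of_succ w₂).ae_eq_primitive hab h₁.integrableOn h₂.integrableOn
    have hRc : ContinuousOn (fun y => ((d2 a b u y - β) / (u y - c) - lam) * φ y) (Icc a b) :=
      (hq.sub continuousOn_const).mul hc
    let R : ℝ → ℝ := IccExtend hab.le
      ((Icc a b).domRestrict (fun y => ((d2 a b u y - β) / (u y - c) - lam) * φ y))
    have hR : Continuous R := (continuousOn_iff_continuous_domRestrict.1 hRc).Icc_extend'
    have hRe : ∀ y ∈ Icc a b, R y = ((d2 a b u y - β) / (u y - c) - lam) * φ y := fun y hy =>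
      IccExtend_of_mem _ _ hy
    have hIoo : ∀ᵐ y ∂(volume.restrict (Ioo a b)), y ∈ Icc a b := by
      rw [ae_restrict_iff' measurableSet_Ioo]
      exact ae_of_all _ fun y hy => Ioo_subset_Icc_self hy
    have E₂ : ∀ᵐ y ∂(volume.restrict (Ioo a b)), φ₂ y = R y := by
      filter_upwards [heq, hIoo] with y hy hy'
      rw [hRe y hy']
      linarith
    let Φ₁ : ℝ → ℝ := fun y => k₁ + ∫ t in a..y, R t
    let Φ : ℝ → ℝ := fun y => k₀ + ∫ t in a..y, Φ₁ t
    have D₁ : ∀ y, HasDerivAt Φ₁ (R y) y := hasDerivAt_primitive hR k₁ a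
    have c₁ : Continuous Φ₁ := continuous_iff_continuousAt.2 fun y => (D₁ y).continuousAt
    have D₀ : ∀ y, HasDerivAt Φ (Φ₁ y) y := hasDerivAt_primitive c₁ k₀ a
    have c₀ : Continuous Φ := continuous_iff_continuousAt.2 fun y => (D₀ y).continuousAt
    have E₁ : ∀ᵐ y ∂(volume.restrict (Ioo a b)), g₁ y = Φ₁ y := by
      filter_upwards [e₁, hIoo] with y hy hy'
      rw [hy, primitive_congr_ae E₂ hy']
    have E₀ : ∀ᵐ y ∂(volume.restrict (Ioo a b)), φ y = Φ y := by
      filter_upwards [e₀, hIoo] with y hy hy'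
      rw [hy, primitive_congr_ae E₁ hy']
    have hEq := eqOn_Icc_of_ae_eq hab hc c₀.continuousOn E₀
    obtain ⟨y, hy, hy0⟩ := hne
    refine ⟨Φ, Φ₁, R, D₀, D₁, hR, fun z hz => ?_, ?_, ?_, y, hy, ?_⟩
    · rw [hRe z hz, hEq hz]
    · rw [← hEq (left_mem_Icc.2 hab.le), ha]
    · rw [← hEq (right_mem_Icc.2 hab.le), hb]
    · rwa [← hEq hy]
  · rintro ⟨φ, φ₁, φ₂, D₀, D₁, c₂, heq, ha, hb, hne⟩
    have c₁ : Continuous φ₁ := continuous_iff_continuousAt.2 fun y => (D₁ y).continuousAt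
    have c₀ : Continuous φ := continuous_iff_continuousAt.2 fun y => (D₀ y).continuousAt
    have w₁ : IsWeakDeriv 1 a b φ φ₁ := fun η hη hc hs => by
      rw [iteratedDeriv_one, pow_one, neg_one_mul]
      exact integral_mul_deriv_test hab D₀ c₁ hη hs
    have w₂ : IsWeakDeriv 2 a b φ φ₂ := fun η hη hc hs => by
      rw [iteratedDeriv_succ, iteratedDeriv_one,
        integral_mul_deriv_test hab D₀ c₁ (contDiff_infty_iff_deriv.1 hη).2
          (tsupport_deriv_subset.trans hs), integral_mul_deriv_test hab D₁ c₂ hη hs]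
      ring
    refine ⟨φ, φ₂, c₀.continuousOn, ⟨memL2_of_continuous c₀, fun j hj => ?_⟩, ha, hb, hne,
      memL2_of_continuous c₂, w₂, ?_⟩
    · interval_cases j
      · exact ⟨φ, memL2_of_continuous c₀, fun η _ _ _ => by simp⟩
      · exact ⟨φ₁, memL2_of_continuous c₁, w₁⟩
      · exact ⟨φ₂, memL2_of_continuous c₂, w₂⟩
    · rw [ae_restrict_iff' measurableSet_Ioo]
      refine ae_of_all _ fun y hy => ?_
      rw [heq y (Ioo_subset_Icc_self hy)]
      ring

/-! ### The Riccati inequality and Jacobi's argument. -/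

/-- A solution `w` of the Riccati inequality `w' + w² ≤ p` bounds the quadratic form with
potential `p` from below by the boundary terms of `F = w φ²`. -/
theorem riccati_le_integral {s t : ℝ} (hst : s ≤ t) {φ φ₁ p w w₁ F : ℝ → ℝ}
    (hφ : ∀ y ∈ Ioo s t, HasDerivAt φ (φ₁ y) y)
    (hint : ContinuousOn (fun y => φ₁ y ^ 2 + p y * φ y ^ 2) (Icc s t))
    (hw : ∀ y ∈ Ioo s t, HasDerivAt w (w₁ y) y) (hF : ContinuousOn F (Icc s t))
    (hFe : ∀ y ∈ Ioo s t, F y = w y * φ y ^ 2)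
    (hle : ∀ y ∈ Ioo s t, w₁ y + w y ^ 2 ≤ p y) :
    F t - F s ≤ ∫ y in s..t, (φ₁ y ^ 2 + p y * φ y ^ 2) := by
  -- `F` is kept apart from `w φ²` because `w` may blow up at the endpoints, where only the
  -- continuous extension `F` has a meaning.
  refine intervalIntegral.sub_le_integral_of_hasDeriv_right_of_le
    (g' := fun y => w₁ y * φ y ^ 2 + w y * (2 * φ y * φ₁ y)) hst hF (fun y hy => ?_)
    (hint.integrableOn_Icc) fun y hy => ?_
  · have h1 : HasDerivAt (fun y => w y * φ y ^ 2) (w₁ y * φ y ^ 2 + w y * (2 * φ y * φ₁ y)) y := by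
      refine ((hw y hy).mul ((hφ y hy).pow 2)).congr_deriv ?_
      simp only [Pi.pow_apply]
      push_cast
      ring
    refine (h1.congr_of_eventuallyEq ?_).hasDerivWithinAt
    filter_upwards [Ioo_mem_nhds hy.1 hy.2] with z hz using hFe z hz
  -- Completing the square: `2 w φ φ₁ ≤ φ₁² + w² φ²`.
  · nlinarith [mul_le_mul_of_nonneg_right (hle y hy) (sq_nonneg (φ y)),
      sq_nonneg (φ₁ y - w y * φ y)]

theorem tendsto_div_of_hasDerivAt {η ψ : ℝ → ℝ} {e c d : ℝ} (hη : HasDerivAt η c e)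
    (hη0 : η e = 0) (hψ : HasDerivAt ψ d e) (hψ0 : ψ e = 0) (hd : d ≠ 0) :
    Tendsto (fun y => η y / ψ y) (𝓝[≠] e) (𝓝 (c / d)) := by
  have h := (hasDerivAt_iff_tendsto_slope.1 hη).div (hasDerivAt_iff_tendsto_slope.1 hψ) hd
  refine h.congr' ?_
  filter_upwards [self_mem_nhdsWithin] with y hy
  have hy' : y - e ≠ 0 := sub_ne_zero.2 hy
  simp only [Pi.div_apply, slope_def_field, hη0, hψ0, sub_zero]
  field_simp

/-- At a common zero the quotient is `η · (η / ψ)`, where the second factor has a finite limit; the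
limit 0 agrees with the value given by division by zero. This makes the boundary terms of a singular
`w` vanish. -/
theorem continuousAt_sq_div {η ψ : ℝ → ℝ} {e c d : ℝ} (hη : HasDerivAt η c e) (hη0 : η e = 0)
    (hψ : HasDerivAt ψ d e) (h : ψ e ≠ 0 ∨ d ≠ 0) :
    ContinuousAt (fun y => η y ^ 2 / ψ y) e := by
  by_cases hψ0 : ψ e = 0
  · have hd : d ≠ 0 := h.resolve_left (not_not.2 hψ0)
    rw [continuousAt_iff_punctured_nhds]
    have h1 := (hη.continuousAt.tendsto.mono_left nhdsWithin_le_nhds).mul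
      (tendsto_div_of_hasDerivAt hη hη0 hψ hψ0 hd)
    rw [hη0, zero_mul] at h1
    simp only [hη0, ne_eq, OfNat.ofNat_ne_zero, not_false_eq_true, zero_pow, zero_div]
    refine h1.congr fun y => ?_
    ring
  · exact (hη.continuousAt.pow 2).div hψ.continuousAt hψ0

/-- Jacobi's inequality: the form with potential `Q` is nonnegative on functions vanishing at the
endpoints if `ψ'' = Q ψ` has a solution which is positive in the interior. -/
theorem integral_nonneg_of_pos_solution {a b : ℝ} (hab : a < b) {Q ψ ψ₁ ψ₂ : ℝ → ℝ}
    (hQ : ContinuousOn Q (Icc a b)) (h₀ : ∀ y, HasDerivAt ψ (ψ₁ y) y)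
    (h₁ : ∀ y, HasDerivAt ψ₁ (ψ₂ y) y) (heq : ∀ y ∈ Icc a b, ψ₂ y = Q y * ψ y)
    (hpos : ∀ y ∈ Ioo a b, 0 < ψ y) (ha : ψ a ≠ 0 ∨ ψ₁ a ≠ 0) (hb : ψ b ≠ 0 ∨ ψ₁ b ≠ 0)
    {η η₁ : ℝ → ℝ} (hη : ∀ y, HasDerivAt η (η₁ y) y) (hη₁ : Continuous η₁) (hηa : η a = 0)
    (hηb : η b = 0) : 0 ≤ ∫ y in a..b, (η₁ y ^ 2 + Q y * η y ^ 2) := by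
  have hηc : Continuous η := continuous_iff_continuousAt.2 fun y => (hη y).continuousAt
  -- The logarithmic derivative `ψ₁ / ψ` solves the Riccati equation `w' + w² = Q` with equality.
  have key := riccati_le_integral hab.le (φ := η) (φ₁ := η₁) (p := Q) (w := fun y => ψ₁ y / ψ y)
    (w₁ := fun y => (ψ₂ y * ψ y - ψ₁ y * ψ₁ y) / ψ y ^ 2)
    (F := fun y => ψ₁ y * (η y ^ 2 / ψ y)) (fun y _ => hη y)
    ((hη₁.pow 2).continuousOn.add (hQ.mul (hηc.pow 2).continuousOn))
    (fun y hy => (h₁ y).div (h₀ y) (hpos y hy).ne') (fun y hy => ?_) (fun y _ => by ring)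
    (fun y hy => ?_)
  · simpa [hηa, hηb] using key
  · refine ContinuousAt.continuousWithinAt ((h₁ y).continuousAt.mul ?_)
    rcases hy.1.eq_or_lt with rfl | h1
    · exact continuousAt_sq_div (hη _) hηa (h₀ _) ha
    rcases hy.2.eq_or_lt with rfl | h2
    · exact continuousAt_sq_div (hη _) hηb (h₀ _) hb
    exact ((hη y).continuousAt.pow 2).div (h₀ y).continuousAt (hpos y ⟨h1, h2⟩).ne'
  · have := (hpos y hy).ne'
    rw [heq y (Ioo_subset_Icc_self hy)]
    apply le_of_eq
    field_simp
    ring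

/-! ### The initial value problem and its dependence on the spectral parameter. -/

/-- A solution of `ψ'' = Q ψ` with nonzero Cauchy data at `a` has no double zero. -/
theorem ne_zero_or_deriv_ne_zero {a b : ℝ} {Q ψ ψ₁ ψ₂ : ℝ → ℝ}
    (hQ : ContinuousOn Q (Icc a b)) (h₀ : ∀ y, HasDerivAt ψ (ψ₁ y) y)
    (h₁ : ∀ y, HasDerivAt ψ₁ (ψ₂ y) y) (heq : ∀ y ∈ Icc a b, ψ₂ y = Q y * ψ y)
    (ha : ψ₁ a ≠ 0) {y : ℝ} (hy : y ∈ Icc a b) : ψ y ≠ 0 ∨ ψ₁ y ≠ 0 := by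
  by_contra! hz
  obtain ⟨M, hM⟩ := isCompact_Icc.exists_bound_of_continuousOn hQ
  -- The derivative of the energy `ψ² + ψ₁²` is `2 (1 + Q) ψ ψ₁`, at least `-(1 + M)` times the
  -- energy, so multiplying by `exp (K z)` makes it monotone. Positive at `a`, it cannot vanish
  -- later.
  set K := M + 1
  have hE : ∀ z, HasDerivAt (fun z => (ψ z ^ 2 + ψ₁ z ^ 2) * Real.exp (K * z))
      ((2 * ψ z * ψ₁ z + 2 * ψ₁ z * ψ₂ z) * Real.exp (K * z) +
        (ψ z ^ 2 + ψ₁ z ^ 2) * (Real.exp (K * z) * K)) z := fun z => by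
    have e1 := ((h₀ z).pow 2).add ((h₁ z).pow 2)
    have e2 : HasDerivAt (fun z => Real.exp (K * z)) (Real.exp (K * z) * K) z := by
      simpa using ((hasDerivAt_id z).const_mul K).exp
    refine (e1.mul e2).congr_deriv ?_
    simp only [Pi.add_apply, Pi.pow_apply]
    push_cast
    ring
  have hmono : MonotoneOn (fun z => (ψ z ^ 2 + ψ₁ z ^ 2) * Real.exp (K * z)) (Icc a b) := by
    refine monotoneOn_of_deriv_nonneg (convex_Icc a b)
      (fun z _ => (hE z).continuousAt.continuousWithinAt)
      (fun z _ => (hE z).differentiableAt.differentiableWithinAt) fun z hz => ?_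
    rw [(hE z).deriv]
    have hz' := interior_subset hz
    rw [heq z hz']
    have hq := abs_le.1 (hM z hz')
    have : 0 ≤ (2 * ψ z * ψ₁ z + 2 * ψ₁ z * (Q z * ψ z)) + (ψ z ^ 2 + ψ₁ z ^ 2) * K := by
      have h3 : 0 ≤ (1 + M + (1 + Q z)) * (ψ z + ψ₁ z) ^ 2 +
        (1 + M - (1 + Q z)) * (ψ z - ψ₁ z) ^ 2 := by
        have h5 : 0 ≤ 1 + M + (1 + Q z) := by linarith [hq.1]
        have h6 : 0 ≤ 1 + M - (1 + Q z) := by linarith [hq.2]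
        positivity
      nlinarith
    have hexp := Real.exp_pos (K * z)
    nlinarith [mul_nonneg this hexp.le]
  have hle := hmono (left_mem_Icc.2 (hy.1.trans hy.2)) hy hy.1
  simp only [hz.1, hz.2] at hle
  have : 0 < (ψ a ^ 2 + ψ₁ a ^ 2) * Real.exp (K * a) := by positivity
  linarith

noncomputable section

/-- The integration operator `f ↦ ∫ₐ f` on `C([a, b])`. -/
def primitiveCLM {a b : ℝ} (hab : a ≤ b) : C(Icc a b, ℝ) →L[ℝ] C(Icc a b, ℝ) :=
  LinearMap.mkContinuous
    { toFun := fun f => ⟨fun y => ∫ t in a..y, IccExtend hab f t, by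
        have hf : Continuous (IccExtend hab f) := f.continuous.Icc_extend'
        exact (intervalIntegral.continuous_primitive (fun _ _ => hf.intervalIntegrable _ _) a).comp
          continuous_subtype_val⟩
      map_add' := fun f g => by
        ext y
        have hf : Continuous (IccExtend hab f) := f.continuous.Icc_extend'
        have hg : Continuous (IccExtend hab g) := g.continuous.Icc_extend'
        exact intervalIntegral.integral_add (hf.intervalIntegrable _ _) (hg.intervalIntegrable _ _)
      map_smul' := fun r f => by
        ext y
        exact intervalIntegral.integral_smul (μ := volume) (a := a) (b := y) r (IccExtend hab f) }
    (b - a) (fun f => by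
      rw [ContinuousMap.norm_le _ (mul_nonneg (sub_nonneg.2 hab) (norm_nonneg _))]
      intro y
      have h := intervalIntegral.norm_integral_le_of_norm_le_const (a := a) (b := y)
        (f := IccExtend hab f) (C := ‖f‖) fun t _ => f.norm_coe_le_norm _
      refine h.trans ?_
      rw [abs_of_nonneg (sub_nonneg.2 y.2.1), mul_comm]
      exact mul_le_mul_of_nonneg_right (by linarith [y.2.2]) (norm_nonneg _))

theorem primitiveCLM_apply {a b : ℝ} (hab : a ≤ b) (f : C(Icc a b, ℝ)) (y : Icc a b) :
    primitiveCLM hab f y = ∫ t in a..y, IccExtend hab f t := rfl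

theorem abs_primitiveCLM_le {a b : ℝ} (hab : a ≤ b) {f : C(Icc a b, ℝ)} {K : ℝ} {n : ℕ}
    (hf : ∀ y, |f y| ≤ K * (y - a) ^ n / n.factorial) (y : Icc a b) :
    |primitiveCLM hab f y| ≤ K * (y - a) ^ (n + 1) / (n + 1).factorial := by
  rw [primitiveCLM_apply]
  have hd : ∀ t, HasDerivAt (fun t : ℝ => K * (t - a) ^ (n + 1) / (n + 1).factorial)
      (K * (t - a) ^ n / n.factorial) t := fun t => by
    have h := ((((hasDerivAt_id t).sub_const a).pow (n + 1)).const_mul K).div_const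
      ((n + 1).factorial : ℝ)
    refine h.congr_deriv ?_
    rw [Nat.factorial_succ]
    push_cast
    have : (n.factorial : ℝ) ≠ 0 := by positivity
    have : (n + 1 : ℝ) ≠ 0 := by positivity
    simp
    field_simp
  have hc : Continuous fun t : ℝ => K * (t - a) ^ n / n.factorial := by fun_prop
  have hi := intervalIntegral.integral_eq_sub_of_hasDerivAt (a := a) (b := y) (fun t _ => hd t)
    (hc.intervalIntegrable _ _)
  have hle := intervalIntegral.norm_integral_le_of_norm_le (a := a) (b := (y : ℝ))
    (f := IccExtend hab f) (μ := volume) y.2.1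
    (ae_of_all _ fun t ht => show ‖IccExtend hab f t‖ ≤ K * (t - a) ^ n / n.factorial by
      rw [IccExtend_of_mem hab f ⟨ht.1.le, ht.2.trans y.2.2⟩]
      exact hf _) (hc.intervalIntegrable _ _)
  rw [hi] at hle
  simpa using hle

/-- The Volterra operator whose fixed point equation is `ψ'' = p ψ`. -/
def volterra {a b : ℝ} (hab : a ≤ b) (p : C(Icc a b, ℝ)) : C(Icc a b, ℝ) →L[ℝ] C(Icc a b, ℝ) :=
  primitiveCLM hab ∘L primitiveCLM hab ∘L ContinuousLinearMap.mul ℝ C(Icc a b, ℝ) p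

theorem volterra_apply {a b : ℝ} (hab : a ≤ b) (p f : C(Icc a b, ℝ)) :
    volterra hab p f = primitiveCLM hab (primitiveCLM hab (p * f)) := rfl

/-- Each application integrates twice, which produces the factorial of `2 * n`. -/
theorem abs_volterra_pow_le {a b : ℝ} (hab : a ≤ b) (p f : C(Icc a b, ℝ)) (n : ℕ) (y : Icc a b) :
    |(volterra hab p ^ n) f y| ≤ ‖p‖ ^ n * ‖f‖ * (y - a) ^ (2 * n) / (2 * n).factorial := by
  induction n generalizing y with
  | zero => simpa using f.norm_coe_le_norm y
  | succ n ih =>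
    rw [pow_succ', mul_apply_eq_comp, volterra_apply]
    refine abs_primitiveCLM_le hab (n := 2 * n + 1) (fun y => ?_) y
    refine abs_primitiveCLM_le hab (n := 2 * n) (fun y => ?_) y
    rw [ContinuousMap.mul_apply, abs_mul]
    calc |p y| * |(volterra hab p ^ n) f y|
        ≤ ‖p‖ * (‖p‖ ^ n * ‖f‖ * (y - a) ^ (2 * n) / (2 * n).factorial) :=
          mul_le_mul (p.norm_coe_le_norm y) (ih y) (abs_nonneg _) (norm_nonneg _)
      _ = _ := by rw [pow_succ']; ring

/-- Factorial decay makes some power of the operator `T` a strict contraction, although `T` need not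
be one; the invertible `1 - T ^ n` factors as `1 - T` times a geometric sum commuting with it. -/
theorem isUnit_one_sub_volterra {a b : ℝ} (hab : a ≤ b) (p : C(Icc a b, ℝ)) :
    IsUnit (1 - volterra hab p) := by
  set r := (‖p‖ + 1) * (b - a + 1)
  have hr := (FloorSemiring.tendsto_pow_div_factorial_atTop r).comp
    (tendsto_id.const_mul_atTop' (show 0 < 2 by norm_num))
  obtain ⟨n, hn⟩ := ((tendsto_order.1 hr).2 1 one_pos).exists
  simp only [Function.comp_apply, id_eq] at hn
  have hba : 0 ≤ b - a := sub_nonneg.2 hab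
  have hT : ‖volterra hab p ^ n‖ < 1 := by
    refine lt_of_le_of_lt (ContinuousLinearMap.opNorm_le_bound _ (by positivity) fun f => ?_) hn
    rw [ContinuousMap.norm_le _ (by positivity)]
    intro y
    refine (abs_volterra_pow_le hab p f n y).trans ?_
    have h1 : ((y : ℝ) - a) ^ (2 * n) ≤ (b - a + 1) ^ (2 * n) :=
      pow_le_pow_left₀ (sub_nonneg.2 y.2.1) (by linarith [y.2.2]) _
    have h2 : ‖p‖ ^ n ≤ (‖p‖ + 1) ^ (2 * n) :=
      (pow_le_pow_left₀ (norm_nonneg _) (by linarith) n).trans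
        (pow_le_pow_right₀ (by linarith [norm_nonneg p]) (by omega))
    have h0 : (0 : ℝ) ≤ (y - a) ^ (2 * n) := pow_nonneg (sub_nonneg.2 y.2.1) _
    calc ‖p‖ ^ n * ‖f‖ * (y - a) ^ (2 * n) / (2 * n).factorial
        = (‖p‖ ^ n * (y - a) ^ (2 * n)) / (2 * n).factorial * ‖f‖ := by ring
      _ ≤ ((‖p‖ + 1) ^ (2 * n) * (b - a + 1) ^ (2 * n)) / (2 * n).factorial * ‖f‖ := by gcongr
      _ = _ := by rw [← mul_pow]
  have hu : IsUnit (1 - volterra hab p ^ n) :=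
    isUnit_one_sub_of_norm_lt_one (R := C(Icc a b, ℝ) →L[ℝ] C(Icc a b, ℝ)) hT
  rw [← mul_neg_geom_sum] at hu
  refine ((Commute.isUnit_mul_iff ?_).1 hu).1
  exact (mul_neg_geom_sum _ _).trans (geom_sum_mul_neg _ _).symm

/-- The solutions of `ψ'' = (Q - lam) ψ`, `ψ(a) = 0`, `ψ'(a) = 1` depend continuously on `lam`. -/
theorem exists_solution_family {a b : ℝ} (hab : a ≤ b) {Q : ℝ → ℝ} (hQ : ContinuousOn Q (Icc a b)) :
    ∃ ψ ψ₁ ψ₂ : ℝ → ℝ → ℝ, (∀ l y, HasDerivAt (ψ l) (ψ₁ l y) y) ∧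
      (∀ l y, HasDerivAt (ψ₁ l) (ψ₂ l y) y) ∧ (∀ l, Continuous (ψ₂ l)) ∧
      (∀ l, ∀ y ∈ Icc a b, ψ₂ l y = (Q y - l) * ψ l y) ∧ (∀ l, ψ l a = 0) ∧ (∀ l, ψ₁ l a = 1) ∧
      ContinuousOn (fun z : ℝ × ℝ => ψ z.1 z.2) (univ ×ˢ Icc a b) ∧
      ContinuousOn (fun z : ℝ × ℝ => ψ₁ z.1 z.2) (univ ×ˢ Icc a b) := by
  let q : C(Icc a b, ℝ) := ⟨(Icc a b).domRestrict Q, continuousOn_iff_continuous_domRestrict.1 hQ⟩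
  let p : ℝ → C(Icc a b, ℝ) := fun l => q - ContinuousMap.const _ l
  let v₀ : C(Icc a b, ℝ) := ⟨fun y => y - a, by fun_prop⟩
  -- The integral form of the problem is `v = (y - a) + T v`. Inversion is continuous at units, so
  -- `v l` depends continuously on `l` in the uniform norm.
  let v : ℝ → C(Icc a b, ℝ) := fun l => Ring.inverse (1 - volterra hab (p l)) v₀
  have hp : Continuous p := by
    refine continuous_const.sub ?_
    exact ContinuousMap.continuous_const'
  have hT : Continuous fun l => volterra hab (p l) := by
    unfold volterra
    fun_prop
  have hv : Continuous v := by
    have : Continuous fun l => Ring.inverse (1 - volterra hab (p l)) := by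
      refine continuous_iff_continuousAt.2 fun l => ?_
      obtain ⟨w, hw⟩ := isUnit_one_sub_volterra hab (p l)
      refine ContinuousAt.comp (g := Ring.inverse) ?_ (continuous_const.sub hT).continuousAt
      rw [← hw]
      exact NormedRing.inverse_continuousAt (R := C(Icc a b, ℝ) →L[ℝ] C(Icc a b, ℝ)) w
    exact this.clm_apply continuous_const
  have hfix : ∀ l, v l = v₀ + volterra hab (p l) (v l) := fun l => by
    have h := congrArg (fun A : C(Icc a b, ℝ) →L[ℝ] C(Icc a b, ℝ) => A v₀)
      (Ring.mul_inverse_cancel _ (isUnit_one_sub_volterra hab (p l)))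
    simp only [mul_apply_eq_comp, sub_apply,
      one_apply_eq_self] at h
    exact sub_eq_iff_eq_add.1 h
  let R : ℝ → ℝ → ℝ := fun l => IccExtend hab (p l * v l)
  have hR : ∀ l, Continuous (R l) := fun l => (p l * v l).continuous.Icc_extend'
  let ψ₁ : ℝ → ℝ → ℝ := fun l y => 1 + ∫ t in a..y, R l t
  let ψ : ℝ → ℝ → ℝ := fun l y => 0 + ∫ t in a..y, ψ₁ l t
  have D₁ : ∀ l y, HasDerivAt (ψ₁ l) (R l y) y := fun l y => hasDerivAt_primitive (hR l) 1 a y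
  have c₁ : ∀ l, Continuous (ψ₁ l) := fun l =>
    continuous_iff_continuousAt.2 fun y => (D₁ l y).continuousAt
  have D₀ : ∀ l y, HasDerivAt (ψ l) (ψ₁ l y) y := fun l y => hasDerivAt_primitive (c₁ l) 0 a y
  have e₁ : ∀ l, ∀ y (hy : y ∈ Icc a b),
      ψ₁ l y = 1 + primitiveCLM hab (p l * v l) ⟨y, hy⟩ := fun l y hy => rfl
  have e₀ : ∀ l, ∀ y (hy : y ∈ Icc a b), ψ l y = v l ⟨y, hy⟩ := fun l y hy => by
    rw [hfix l, ContinuousMap.add_apply, volterra_apply, primitiveCLM_apply]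
    have : ψ l y = ∫ t in a..y, (1 + IccExtend hab (primitiveCLM hab (p l * v l)) t) := by
      simp only [ψ, zero_add]
      refine intervalIntegral.integral_congr fun t ht => ?_
      rw [uIcc_of_le hy.1] at ht
      have ht' : t ∈ Icc a b := ⟨ht.1, ht.2.trans hy.2⟩
      simp only [IccExtend_of_mem hab _ ht', e₁ l t ht']
    rw [this, intervalIntegral.integral_add (by simp)
      (((primitiveCLM hab (p l * v l)).continuous.Icc_extend').intervalIntegrable _ _)]
    simp [v₀]
  have hj : ∀ F : ℝ → C(Icc a b, ℝ), Continuous F →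
      Continuous fun z : ℝ × ℝ => F z.1 (projIcc a b hab z.2) := fun F hF => by
    have : Continuous (projIcc a b hab) := continuous_projIcc
    fun_prop
  refine ⟨ψ, ψ₁, R, D₀, D₁, hR, fun l y hy => ?_, fun l => by simp [ψ], fun l => by simp [ψ₁],
    ?_, ?_⟩
  · rw [e₀ l y hy]
    simp only [R]
    rw [IccExtend_of_mem hab _ hy]
    rfl
  · refine (hj v hv).continuousOn.congr fun z hz => ?_
    have hz' : z.2 ∈ Icc a b := hz.2
    simp only
    rw [e₀ z.1 z.2 hz', projIcc_of_mem hab hz']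
  · have hF : Continuous fun l => primitiveCLM hab (p l * v l) := by fun_prop
    refine ((continuous_const (y := (1 : ℝ))).add (hj _ hF)).continuousOn.congr fun z hz => ?_
    have hz' : z.2 ∈ Icc a b := hz.2
    simp only [Pi.add_apply]
    rw [e₁ z.1 z.2 hz', projIcc_of_mem hab hz']

end

/-! ### The first eigenvalue by shooting. -/

/-- Integration by parts: the quadratic form of an eigenfunction. -/
theorem integral_form_eq_of_eq {a b lam : ℝ} (hab : a ≤ b) {Q φ φ₁ φ₂ : ℝ → ℝ}
    (hQ : ContinuousOn Q (Icc a b)) (h₀ : ∀ y, HasDerivAt φ (φ₁ y) y)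
    (h₁ : ∀ y, HasDerivAt φ₁ (φ₂ y) y) (heq : ∀ y ∈ Icc a b, φ₂ y = (Q y - lam) * φ y)
    (ha : φ a = 0) (hb : φ b = 0) :
    ∫ y in a..b, (φ₁ y ^ 2 + Q y * φ y ^ 2) = lam * ∫ y in a..b, φ y ^ 2 := by
  have c₁ : Continuous φ₁ := continuous_iff_continuousAt.2 fun y => (h₁ y).continuousAt
  have c₀ : Continuous φ := continuous_iff_continuousAt.2 fun y => (h₀ y).continuousAt
  have hQ' : ContinuousOn Q (uIcc a b) := by rwa [uIcc_of_le hab]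
  have hi : IntervalIntegrable (fun y => φ₁ y ^ 2 + Q y * φ y ^ 2 - lam * φ y ^ 2) volume a b := by
    apply ContinuousOn.intervalIntegrable
    fun_prop
  have hi' : IntervalIntegrable (fun y => lam * φ y ^ 2) volume a b := by
    apply Continuous.intervalIntegrable
    fun_prop
  have key := intervalIntegral.integral_eq_sub_of_hasDerivAt (a := a) (b := b)
    (f := fun y => φ y * φ₁ y) (f' := fun y => φ₁ y ^ 2 + Q y * φ y ^ 2 - lam * φ y ^ 2)
    (fun y hy => by
      refine ((h₀ y).mul (h₁ y)).congr_deriv ?_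
      rw [uIcc_of_le hab] at hy
      rw [heq y hy]
      ring) hi
  rw [ha, hb, zero_mul, zero_mul, sub_zero] at key
  have h2 := intervalIntegral.integral_add hi hi'
  rw [key, zero_add, intervalIntegral.integral_const_mul] at h2
  rw [← h2]
  exact intervalIntegral.integral_congr fun y _ => by simp

theorem integral_sq_pos {a b : ℝ} (hab : a < b) {φ : ℝ → ℝ} (hφ : Continuous φ)
    (hne : ∃ y ∈ Icc a b, φ y ≠ 0) : 0 < ∫ y in a..b, φ y ^ 2 := by
  obtain ⟨y, hy, h0⟩ := hne
  exact intervalIntegral.integral_pos hab (hφ.pow 2).continuousOn (fun _ _ => sq_nonneg _)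
    ⟨y, hy, by positivity⟩

theorem form_sub_const {a b l : ℝ} (hab : a ≤ b) {Q η η₁ : ℝ → ℝ} (hQ : ContinuousOn Q (Icc a b))
    (hη : Continuous η) (hη₁ : Continuous η₁) :
    ∫ y in a..b, (η₁ y ^ 2 + (Q y - l) * η y ^ 2) =
      (∫ y in a..b, (η₁ y ^ 2 + Q y * η y ^ 2)) - l * ∫ y in a..b, η y ^ 2 := by
  have hQ' : ContinuousOn Q (uIcc a b) := by rwa [uIcc_of_le hab]
  rw [← intervalIntegral.integral_const_mul, ← intervalIntegral.integral_sub]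
  · exact intervalIntegral.integral_congr fun y _ => by ring
  · apply ContinuousOn.intervalIntegrable
    fun_prop
  · apply Continuous.intervalIntegrable
    fun_prop

/-- For `lam` below the potential, the solution with `ψ(a) = 0`, `ψ'(a) = 1` stays positive. -/
theorem pos_of_le_potential {a b : ℝ} {Q ψ ψ₁ ψ₂ : ℝ → ℝ}
    (h₀ : ∀ y, HasDerivAt ψ (ψ₁ y) y) (h₁ : ∀ y, HasDerivAt ψ₁ (ψ₂ y) y)
    (heq : ∀ y ∈ Icc a b, ψ₂ y = Q y * ψ y) (hQ : ∀ y ∈ Icc a b, 0 ≤ Q y)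
    (ha : ψ a = 0) (ha₁ : ψ₁ a = 1) {y : ℝ} (hy : y ∈ Ioc a b) : 0 < ψ y := by
  have hψ : Continuous ψ := continuous_iff_continuousAt.2 fun y => (h₀ y).continuousAt
  -- Since `(ψ ψ₁)' = ψ₁² + Q ψ² ≥ 0` and `ψ ψ₁` vanishes at `a`, `ψ²` is nondecreasing: once
  -- positive, `ψ` cannot return to zero.
  have hm1 : MonotoneOn (fun z => ψ z * ψ₁ z) (Icc a b) := by
    have hd : ∀ z, HasDerivAt (fun z => ψ z * ψ₁ z) (ψ₁ z * ψ₁ z + ψ z * ψ₂ z) z := fun z =>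
      (h₀ z).mul (h₁ z)
    refine monotoneOn_of_deriv_nonneg (convex_Icc a b)
      (fun z _ => (hd z).continuousAt.continuousWithinAt)
      (fun z _ => (hd z).differentiableAt.differentiableWithinAt) fun z hz => ?_
    have hz' := interior_subset hz
    rw [(hd z).deriv, heq z hz']
    nlinarith [hQ z hz', sq_nonneg (ψ z), sq_nonneg (ψ₁ z), mul_nonneg (hQ z hz') (sq_nonneg (ψ z))]
  have hm : MonotoneOn (fun z => ψ z ^ 2) (Icc a b) := by
    have hd : ∀ z, HasDerivAt (fun z => ψ z ^ 2) (2 * (ψ z * ψ₁ z)) z := fun z => by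
      refine ((h₀ z).pow 2).congr_deriv ?_
      push_cast
      ring
    refine monotoneOn_of_deriv_nonneg (convex_Icc a b)
      (fun z _ => (hd z).continuousAt.continuousWithinAt)
      (fun z _ => (hd z).differentiableAt.differentiableWithinAt) fun z hz => ?_
    have hz' := interior_subset hz
    rw [(hd z).deriv]
    have := hm1 (left_mem_Icc.2 (hz'.1.trans hz'.2)) hz' hz'.1
    simp only [ha, zero_mul] at this
    linarith
  have hev : ∀ᶠ z in 𝓝[>] a, 0 < ψ z := by
    have := (hasDerivAt_iff_tendsto_slope.1 (h₀ a)).mono_left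
      (nhdsWithin_mono a fun z (hz : a < z) => hz.ne')
    rw [ha₁] at this
    filter_upwards [this.eventually (lt_mem_nhds one_pos), self_mem_nhdsWithin] with z hz hz'
    rw [slope_def_field, ha, sub_zero] at hz
    exact (div_pos_iff_of_pos_right (sub_pos.2 hz')).1 hz
  by_contra! hle
  obtain ⟨z, hz0, hz⟩ := (hev.and (Ioo_mem_nhdsGT hy.1)).exists
  obtain ⟨x, hx, hx0⟩ := intermediate_value_Icc' hz.2.le hψ.continuousOn ⟨hle, hz0.le⟩
  have := hm (a := z) (b := x) ⟨hz.1.le, hz.2.le.trans hy.2⟩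
    ⟨hz.1.le.trans hx.1, hx.2.trans hy.2⟩ hx.1
  simp only [hx0] at this
  nlinarith

/-- Existence and variational characterization of the first eigenvalue of a Sturm-Liouville
problem with continuous potential. -/
theorem exists_first_eigenvalue {a b : ℝ} (hab : a < b) {Q : ℝ → ℝ}
    (hQ : ContinuousOn Q (Icc a b)) :
    ∃ l, IsClassicalEigenvalue a b Q l ∧ ∀ η η₁ : ℝ → ℝ, (∀ y, HasDerivAt η (η₁ y) y) →
      Continuous η₁ → η a = 0 → η b = 0 →
      l * ∫ y in a..b, η y ^ 2 ≤ ∫ y in a..b, (η₁ y ^ 2 + Q y * η y ^ 2) := by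
  obtain ⟨ψ, ψ₁, ψ₂, D₀, D₁, c₂, heq, ha, ha₁, hj, hj₁⟩ := exists_solution_family hab.le hQ
  have c₀ : ∀ l, Continuous (ψ l) := fun l =>
    continuous_iff_continuousAt.2 fun y => (D₀ l y).continuousAt
  have hQl : ∀ l, ContinuousOn (fun y => Q y - l) (Icc a b) := fun l => hQ.sub continuousOn_const
  have hnd : ∀ l, ∀ y ∈ Icc a b, ψ l y ≠ 0 ∨ ψ₁ l y ≠ 0 := fun l y hy =>
    ne_zero_or_deriv_ne_zero (hQl l) (D₀ l) (D₁ l) (heq l) (by rw [ha₁]; exact one_ne_zero) hy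
  -- The eigenvalue will be `sSup S`. The endpoint `b` belongs to the condition, so that at the
  -- supremum positivity can fail only by a zero at `b`.
  let S : Set ℝ := {l | ∀ y ∈ Ioc a b, 0 < ψ l y}
  have hform : ∀ l, (∀ y ∈ Ioo a b, 0 < ψ l y) → ∀ η η₁ : ℝ → ℝ, (∀ y, HasDerivAt η (η₁ y) y) →
      Continuous η₁ → η a = 0 → η b = 0 →
      l * ∫ y in a..b, η y ^ 2 ≤ ∫ y in a..b, (η₁ y ^ 2 + Q y * η y ^ 2) := by
    intro l hl η η₁ hη hη₁ hηa hηb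
    have h := integral_nonneg_of_pos_solution hab (hQl l) (D₀ l) (D₁ l) (heq l) hl
      (hnd l a (left_mem_Icc.2 hab.le)) (hnd l b (right_mem_Icc.2 hab.le)) hη hη₁ hηa hηb
    rw [form_sub_const hab.le hQ (continuous_iff_continuousAt.2 fun y => (hη y).continuousAt)
      hη₁] at h
    linarith
  have hne : S.Nonempty := by
    obtain ⟨M, hM⟩ := isCompact_Icc.exists_bound_of_continuousOn hQ
    refine ⟨-M, fun y hy => pos_of_le_potential (D₀ _) (D₁ _) (heq _) (fun z hz => ?_) (ha _)
      (ha₁ _) hy⟩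
    linarith [(abs_le.1 (hM z hz)).1]
  -- Each `l` in `S` satisfies the variational inequality, hence is at most the Rayleigh quotient of
  -- `(y - a) (b - y)`.
  have hbdd : BddAbove S := by
    have hη : ∀ y, HasDerivAt (fun y : ℝ => (y - a) * (b - y)) ((b - y) - (y - a)) y := fun y => by
      refine (((hasDerivAt_id y).sub_const a).mul ((hasDerivAt_id y).const_sub b)).congr_deriv ?_
      simp
      ring
    have hpos : 0 < ∫ y in a..b, ((y - a) * (b - y)) ^ 2 :=
      integral_sq_pos hab (by fun_prop) ⟨(a + b) / 2, ⟨by linarith, by linarith⟩, by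
        have h1 : 0 < (a + b) / 2 - a := by linarith
        have h2 : 0 < b - (a + b) / 2 := by linarith
        positivity⟩
    refine ⟨(∫ y in a..b, (((b - y) - (y - a)) ^ 2 + Q y * ((y - a) * (b - y)) ^ 2)) /
      ∫ y in a..b, ((y - a) * (b - y)) ^ 2, fun l hl => ?_⟩
    rw [le_div_iff₀ hpos]
    exact hform l (fun y hy => hl y (Ioo_subset_Ioc_self hy)) _ _ hη (by fun_prop) (by simp)
      (by simp)
  set L := sSup S with hL
  have hcl : L ∈ closure S := csSup_mem_closure hne hbdd
  have hnonneg : ∀ y ∈ Icc a b, 0 ≤ ψ L y := by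
    intro y hy
    have hcont : Continuous fun l => ψ l y :=
      hj.comp_continuous (continuous_id.prodMk continuous_const) fun l => ⟨mem_univ _, hy⟩
    rcases hy.1.eq_or_lt with rfl | h
    · rw [ha]
    have : S ⊆ {l | 0 ≤ ψ l y} := fun l hl => (hl y ⟨h, hy.2⟩).le
    exact (isClosed_le continuous_const hcont).closure_subset_iff.2 this hcl
  have hpos : ∀ y ∈ Ioo a b, 0 < ψ L y := by
    intro y hy
    refine lt_of_le_of_ne (hnonneg y (Ioo_subset_Icc_self hy)) fun h0 => ?_
    -- An interior zero of a nonnegative solution is a minimum, hence a double zero, which is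
    -- excluded.
    have hmin : IsLocalMin (ψ L) y := by
      filter_upwards [Icc_mem_nhds hy.1 hy.2] with z hz
      rw [← h0]
      exact hnonneg z hz
    rcases hnd L y (Ioo_subset_Icc_self hy) with h | h
    · exact h h0.symm
    · exact h (hmin.hasDerivAt_eq_zero (D₀ L y))
  have hb0 : ψ L b = 0 := by
    by_contra hne0
    have hbpos : ∀ y ∈ Ioc a b, 0 < ψ L y := by
      intro y hy
      rcases hy.2.eq_or_lt with rfl | h
      · exact lt_of_le_of_ne (hnonneg y ⟨hy.1.le, le_rfl⟩) (Ne.symm hne0)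
      · exact hpos y ⟨hy.1, h⟩
    -- If `ψ L` were positive up to `b`, compactness would keep `ψ l` positive for some `l > L`.
    -- Near `a`, where `ψ` vanishes, strict monotonicity from `ψ₁ > 0` replaces a lower bound.
    have hloc : ∀ y ∈ Icc a b, ∀ᶠ z : ℝ × ℝ in 𝓝 y ×ˢ 𝓝 L,
        z.1 ∈ Ioc a b → 0 < ψ z.2 z.1 := by
      intro y hy
      rcases hy.1.eq_or_lt with rfl | hlt
      · have h1 : ∀ᶠ z in 𝓝[univ ×ˢ Icc a b] ((L, a) : ℝ × ℝ), 0 < ψ₁ z.1 z.2 := by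
          refine (hj₁ (L, a) ⟨mem_univ _, hy⟩).eventually (lt_mem_nhds ?_)
          simp only [ha₁, one_pos]
        rw [eventually_nhdsWithin_iff, nhds_prod_eq] at h1
        obtain ⟨P, hP, P', hP', h2⟩ := eventually_prod_iff.1 h1
        obtain ⟨ε, hε, hball⟩ := Metric.eventually_nhds_iff.1 hP'
        refine eventually_prod_iff.2 ⟨fun y => dist y a < ε,
          Metric.eventually_nhds_iff.2 ⟨ε, hε, fun _ h => h⟩, P, hP, fun {x} hx {l} hl hxI => ?_⟩
        simp only
        simp only at hxI
        have hmono : StrictMonoOn (ψ l) (Icc a x) := by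
          refine strictMonoOn_of_deriv_pos (convex_Icc a x) (c₀ l).continuousOn fun t ht => ?_
          rw [interior_Icc] at ht
          rw [(D₀ l t).deriv]
          refine h2 hl (y := t) (hball ?_) ⟨mem_univ _, ht.1.le, ht.2.le.trans hxI.2⟩
          simp only at hx
          rw [Real.dist_eq, abs_of_pos (sub_pos.2 hxI.1)] at hx
          rw [Real.dist_eq, abs_of_pos (sub_pos.2 ht.1)]
          linarith [ht.2]
        have := hmono (left_mem_Icc.2 hxI.1.le) (right_mem_Icc.2 hxI.1.le) hxI.1
        rwa [ha] at this
      · have h1 : ∀ᶠ z in 𝓝[univ ×ˢ Icc a b] ((L, y) : ℝ × ℝ), 0 < ψ z.1 z.2 :=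
          (hj (L, y) ⟨mem_univ _, hy⟩).eventually (lt_mem_nhds (hbpos y ⟨hlt, hy.2⟩))
        rw [eventually_nhdsWithin_iff, nhds_prod_eq] at h1
        filter_upwards [(eventually_swap_iff (f := 𝓝 L) (g := 𝓝 y)).1 h1] with z hz hzI
        exact hz ⟨mem_univ _, Ioc_subset_Icc_self hzI⟩
    have hall := isCompact_Icc.eventually_forall_of_forall_eventually (K := Icc a b) (x₀ := L)
      (P := fun l y => y ∈ Ioc a b → 0 < ψ l y) (fun y hy => by
        have := hloc y hy
        rw [nhds_prod_eq]
        exact (eventually_swap_iff (f := 𝓝 y) (g := 𝓝 L)).1 this)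
    obtain ⟨l, hl, hl'⟩ := ((hall.filter_mono nhdsWithin_le_nhds).and
      (self_mem_nhdsWithin (a := L) (s := Ioi L))).exists
    have hlS : l ∈ S := fun y hy => hl y (Ioc_subset_Icc_self hy) hy
    exact (le_csSup hbdd hlS).not_gt hl'
  refine ⟨L, ⟨ψ L, ψ₁ L, ψ₂ L, D₀ L, D₁ L, c₂ L, heq L, ha L, hb0, (a + b) / 2,
    ⟨by linarith, by linarith⟩, (hpos _ ⟨by linarith, by linarith⟩).ne'⟩, hform L hpos⟩

/-! ### Uniform form bounds: gluing and Hardy inequalities. -/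

/-- The quadratic forms with potentials `q c`, `c ∈ I`, restricted to `[s, t]`, are bounded below
uniformly in `c` on functions vanishing at `a` and `b`. -/
def FormBound (a b : ℝ) (I : Set ℝ) (q : ℝ → ℝ → ℝ) (s t : ℝ) : Prop :=
  ∃ C, ∀ c ∈ I, ∀ φ φ₁ : ℝ → ℝ, (∀ y, HasDerivAt φ (φ₁ y) y) → Continuous φ₁ → φ a = 0 → φ b = 0 →
    0 ≤ ∫ y in s..t, (φ₁ y ^ 2 + (q c y + C) * φ y ^ 2)

theorem continuousOn_form {s t C : ℝ} {q φ φ₁ : ℝ → ℝ} (hq : ContinuousOn q (Icc s t))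
    (hφ : ∀ y, HasDerivAt φ (φ₁ y) y) (hφ₁ : Continuous φ₁) :
    ContinuousOn (fun y => φ₁ y ^ 2 + (q y + C) * φ y ^ 2) (Icc s t) := by
  have : Continuous φ := continuous_iff_continuousAt.2 fun y => (hφ y).continuousAt
  fun_prop

theorem FormBound.trans {a b : ℝ} {I : Set ℝ} {q : ℝ → ℝ → ℝ} {s t r : ℝ}
    (hq : ∀ c ∈ I, ContinuousOn (q c) (Icc a b)) (has : a ≤ s) (hst : s ≤ t) (htr : t ≤ r)
    (hrb : r ≤ b) (h : FormBound a b I q s t) (h' : FormBound a b I q t r) :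
    FormBound a b I q s r := by
  obtain ⟨C, hC⟩ := h
  obtain ⟨C', hC'⟩ := h'
  refine ⟨max C C', fun c hc φ φ₁ hφ hφ₁ ha hb => ?_⟩
  have hi : ∀ x y K, a ≤ x → x ≤ y → y ≤ b →
      IntervalIntegrable (fun y => φ₁ y ^ 2 + (q c y + K) * φ y ^ 2) volume x y :=
    fun x y K hx hxy hy => by
      apply ContinuousOn.intervalIntegrable
      rw [uIcc_of_le hxy]
      exact continuousOn_form ((hq c hc).mono (Icc_subset_Icc hx hy)) hφ hφ₁
  rw [← intervalIntegral.integral_add_adjacent_intervals (hi s t _ has hst (htr.trans hrb))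
    (hi t r _ (has.trans hst) htr hrb)]
  refine add_nonneg ((hC c hc φ φ₁ hφ hφ₁ ha hb).trans ?_) ((hC' c hc φ φ₁ hφ hφ₁ ha hb).trans ?_)
  · refine intervalIntegral.integral_mono_on hst (hi _ _ _ has hst (htr.trans hrb))
      (hi _ _ _ has hst (htr.trans hrb)) fun y _ => ?_
    gcongr
    exact le_max_left _ _
  · refine intervalIntegral.integral_mono_on htr (hi _ _ _ (has.trans hst) htr hrb)
      (hi _ _ _ (has.trans hst) htr hrb) fun y _ => ?_
    gcongr
    exact le_max_right _ _

/-- Uniform lower bounds on small intervals around every point give a uniform lower bound on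
`[a, b]`. -/
theorem FormBound.of_local {a b : ℝ} (hab : a < b) {I : Set ℝ} {q : ℝ → ℝ → ℝ}
    (hq : ∀ c ∈ I, ContinuousOn (q c) (Icc a b))
    (hloc : ∀ y ∈ Icc a b, ∃ r > 0, ∀ s t, a ≤ s → s ≤ y → y ≤ t → t ≤ b → y - r < s → t < y + r →
      (s < y ∨ y = a) → (y < t ∨ y = b) → FormBound a b I q s t) :
    FormBound a b I q a b := by
  -- Continuous induction. A local window must reach strictly to both sides of an interior centre,
  -- so no bound up to the supremum itself can be expected; `T` therefore asks for bounds only up to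
  -- points slightly below `t`, and the cuts are made there.
  let T : Set ℝ := {t | t ∈ Ioc a b ∧ ∃ s < t, ∀ s' ∈ Ioo s t, a < s' → FormBound a b I q a s'}
  obtain ⟨r₀, hr₀, h₀⟩ := hloc a (left_mem_Icc.2 hab.le)
  have hT₀ : min (a + r₀) b ∈ T := by
    refine ⟨⟨lt_min (by linarith) hab, min_le_right _ _⟩, a, lt_min (by linarith) hab,
      fun s' hs' _ => ?_⟩
    exact h₀ a s' le_rfl le_rfl hs'.1.le (hs'.2.le.trans (min_le_right _ _)) (by linarith)
      (hs'.2.trans_le (min_le_left _ _)) (Or.inr rfl) (Or.inl hs'.1)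
  have hbdd : BddAbove T := ⟨b, fun t ht => ht.1.2⟩
  set τ := sSup T
  have haτ : a < τ := hT₀.1.1.trans_le (le_csSup hbdd hT₀)
  have hτb : τ ≤ b := csSup_le ⟨_, hT₀⟩ fun t ht => ht.1.2
  obtain ⟨r, hr, h⟩ := hloc τ ⟨haτ.le, hτb⟩
  obtain ⟨t, htT, ht⟩ := exists_lt_of_lt_csSup ⟨_, hT₀⟩ (show τ - r < τ by linarith)
  obtain ⟨⟨hat, htb⟩, s, hst, hs⟩ := htT
  have htτ : t ≤ τ := le_csSup hbdd ⟨⟨hat, htb⟩, s, hst, hs⟩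
  obtain ⟨s', hs', hs't⟩ := exists_between (max_lt hst (max_lt ht hat))
  have h1 : s < s' := (le_max_left _ _).trans_lt hs'
  have h2 : τ - r < s' := (le_max_left _ _).trans_lt ((le_max_right _ _).trans_lt hs')
  have h3 : a < s' := (le_max_right _ _).trans_lt ((le_max_right _ _).trans_lt hs')
  have hP := hs s' ⟨h1, hs't⟩ h3
  rcases hτb.eq_or_lt with heq | hlt
  · have := h s' τ h3.le (hs't.le.trans htτ) le_rfl hτb h2 (by linarith) (Or.inl (hs't.trans_le htτ))
      (Or.inr heq)
    rw [heq] at this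
    exact hP.trans hq le_rfl h3.le (hs't.le.trans htb) le_rfl this
  · exfalso
    have hτ' : τ < min (τ + r) b := lt_min (by linarith) hlt
    refine (le_csSup hbdd (show min (τ + r) b ∈ T from
      ⟨⟨haτ.trans hτ', min_le_right _ _⟩, τ, hτ', fun t' ht' _ => ?_⟩)).not_gt hτ'
    have ht'b := ht'.2.le.trans (min_le_right _ _)
    exact hP.trans hq le_rfl h3.le ((hs't.le.trans htτ).trans ht'.1.le) ht'b
      (h s' t' h3.le (hs't.le.trans htτ) ht'.1.le ht'b h2
        (ht'.2.trans_le (min_le_left _ _)) (Or.inl (hs't.trans_le htτ)) (Or.inl ht'.1))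

theorem FormBound.of_le {a b : ℝ} {I : Set ℝ} {q : ℝ → ℝ → ℝ} {s t C : ℝ} (hst : s ≤ t)
    (h : ∀ c ∈ I, ∀ y ∈ Icc s t, -C ≤ q c y) : FormBound a b I q s t := by
  refine ⟨C, fun c hc φ φ₁ _ _ _ _ => intervalIntegral.integral_nonneg hst fun y hy => ?_⟩
  have : 0 ≤ q c y + C := by linarith [h c hc y hy]
  positivity

/-- The Hardy inequality with a lower order perturbation, at the left endpoint. -/
theorem FormBound.of_hardy_left {a b : ℝ} {I : Set ℝ} {q : ℝ → ℝ → ℝ} {t K : ℝ} (hat : a ≤ t)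
    (htK : 2 * K * (t - a) ≤ 1) (hq : ∀ c ∈ I, ContinuousOn (q c) (Icc a t))
    (h : ∀ c ∈ I, ∀ y ∈ Ioc a t, -(1 / (4 * (y - a) ^ 2)) - K / (y - a) - K ≤ q c y) :
    FormBound a b I q a t := by
  rcases hat.eq_or_lt with rfl | hat
  · exact ⟨0, fun _ _ _ _ _ _ _ _ => by simp⟩
  refine ⟨K ^ 2 + K, fun c hc φ φ₁ hφ hφ₁ ha _ => ?_⟩
  -- With `x = y - a`, the Hardy solution `1 / (2 x)` shifted by `-K` gives `w' + w² = -1 / (4 x²) -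
  -- K / x + K²`, so the shift pays for the `K / x` term. The smallness `htK` keeps `w ≥ 0` at `t`.
  have key := riccati_le_integral hat.le (φ := φ) (φ₁ := φ₁) (p := fun y => q c y + (K ^ 2 + K))
    (w := fun y => 1 / (2 * (y - a)) - K) (w₁ := fun y => -(2 / (2 * (y - a)) ^ 2))
    (F := fun y => (1 / 2) * (φ y ^ 2 / (y - a)) - K * φ y ^ 2) (fun y _ => hφ y)
    (continuousOn_form (hq c hc) hφ hφ₁) (fun y hy => ?_) (fun y hy => ?_) (fun y hy => ?_)
    (fun y hy => ?_)
  · refine le_trans ?_ key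
    simp only [ha]
    have hpos : 0 < t - a := sub_pos.2 hat
    have : K ≤ 1 / (2 * (t - a)) := by
      rw [le_div_iff₀ (by positivity)]
      linarith
    have h2 : (1 : ℝ) / 2 * (φ t ^ 2 / (t - a)) = 1 / (2 * (t - a)) * φ t ^ 2 := by field_simp
    rw [h2]
    have := mul_le_mul_of_nonneg_right this (sq_nonneg (φ t))
    have e0 : (1 : ℝ) / 2 * ((0 : ℝ) ^ 2 / (a - a)) - K * 0 ^ 2 = 0 := by simp
    rw [e0]
    linarith
  · have hne : 2 * (y - a) ≠ 0 := by have := hy.1; exact (by linarith : 0 < 2 * (y - a)).ne'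
    have h1 : HasDerivAt (fun y => 2 * (y - a)) 2 y := by
      simpa using ((hasDerivAt_id y).sub_const a).const_mul 2
    simpa [neg_div] using (h1.inv hne).sub_const K
  · have hc0 : ContinuousAt φ y := (hφ y).continuousAt
    refine ContinuousAt.continuousWithinAt (ContinuousAt.sub (continuousAt_const.mul ?_)
      (continuousAt_const.mul (hc0.pow 2)))
    rcases hy.1.eq_or_lt with rfl | h1
    · exact continuousAt_sq_div (hφ _) ha ((hasDerivAt_id _).sub_const _) (Or.inr one_ne_zero)
    · exact (hc0.pow 2).div (by fun_prop) (sub_pos.2 h1).ne'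
  · have hpos : 0 < y - a := sub_pos.2 hy.1
    field_simp
  · have hpos : 0 < y - a := sub_pos.2 hy.1
    have := h c hc y (Ioo_subset_Ioc_self hy)
    have e : -(2 / (2 * (y - a)) ^ 2) + (1 / (2 * (y - a)) - K) ^ 2 =
        -(1 / (4 * (y - a) ^ 2)) - K / (y - a) + K ^ 2 := by
      field_simp
      ring
    rw [e]
    linarith

/-- The Hardy inequality with a lower order perturbation, at the right endpoint. -/
theorem FormBound.of_hardy_right {a b : ℝ} {I : Set ℝ} {q : ℝ → ℝ → ℝ} {s K : ℝ} (hsb : s ≤ b)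
    (hsK : 2 * K * (b - s) ≤ 1) (hq : ∀ c ∈ I, ContinuousOn (q c) (Icc s b))
    (h : ∀ c ∈ I, ∀ y ∈ Ico s b, -(1 / (4 * (b - y) ^ 2)) - K / (b - y) - K ≤ q c y) :
    FormBound a b I q s b := by
  rcases hsb.eq_or_lt with rfl | hsb
  · exact ⟨0, fun _ _ _ _ _ _ _ _ => by simp⟩
  have hle : -b ≤ -s := by linarith
  -- Reflection `y ↦ -y` exchanges the two endpoints.
  obtain ⟨C, hC⟩ := FormBound.of_hardy_left (a := -b) (b := -a) (I := I) (t := -s)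
    (q := fun c y => q c (-y)) hle (by linarith)
    (fun c hc => (hq c hc).comp continuous_neg.continuousOn fun y hy =>
      ⟨by linarith [hy.2], by linarith [hy.1]⟩)
    (fun c hc y hy => by
      have := h c hc (-y) ⟨by linarith [hy.2], by linarith [hy.1]⟩
      simpa [add_comm] using this)
  refine ⟨C, fun c hc φ φ₁ hφ hφ₁ ha hb => ?_⟩
  have := hC c hc (fun y => φ (-y)) (fun y => -φ₁ (-y))
    (fun y => ((hφ (-y)).comp y (hasDerivAt_neg y)).congr_deriv (by simp)) (by fun_prop) (by simpa using hb)
    (by simpa using ha)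
  have e := intervalIntegral.integral_comp_neg (a := -b) (b := -s)
    (fun y => φ₁ y ^ 2 + (q c y + C) * φ y ^ 2)
  simp only [neg_neg] at e
  rw [← e]
  simpa using this

/-! ### Taylor expansions of the profile and comparison with the Hardy potential. -/

theorem abs_le_mul_of_abs_deriv_le {f f' : ℝ → ℝ} {B y₀ y : ℝ} (hf : ∀ z, HasDerivAt f (f' z) z)
    (h0 : f y₀ = 0) (hB : ∀ z ∈ uIcc y₀ y, |f' z| ≤ B) : |f y| ≤ B * |y - y₀| := by
  have h := (convex_uIcc y₀ y).norm_image_sub_le_of_norm_hasDerivWithin_le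
    (fun z _ => (hf z).hasDerivWithinAt) hB left_mem_uIcc right_mem_uIcc
  rwa [h0, sub_zero] at h

namespace Profile

variable {a b : ℝ} {U U₁ U₂ U₃ : ℝ → ℝ}

theorem continuous₀ (h : Profile a b U U₁ U₂ U₃) : Continuous U :=
  continuous_iff_continuousAt.2 fun y => (h.hasDerivAt₀ y).continuousAt

theorem continuous₁ (h : Profile a b U U₁ U₂ U₃) : Continuous U₁ :=
  continuous_iff_continuousAt.2 fun y => (h.hasDerivAt₁ y).continuousAt

theorem continuous₂ (h : Profile a b U U₁ U₂ U₃) : Continuous U₂ :=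
  continuous_iff_continuousAt.2 fun y => (h.hasDerivAt₂ y).continuousAt

theorem neg (h : Profile a b U U₁ U₂ U₃) :
    Profile a b (fun y => -U y) (fun y => -U₁ y) (fun y => -U₂ y) (fun y => -U₃ y) where
  hasDerivAt₀ y := (h.hasDerivAt₀ y).neg
  hasDerivAt₁ y := (h.hasDerivAt₁ y).neg
  hasDerivAt₂ y := (h.hasDerivAt₂ y).neg
  continuous₃ := h.continuous₃.neg
  holder := by
    obtain ⟨C, hC⟩ := h.holder
    refine ⟨C, fun x hx y hy => ?_⟩
    rw [← neg_sub', abs_neg]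
    exact hC x hx y hy
  nondegenerate y hy h0 := neg_ne_zero.2 (h.nondegenerate y hy (neg_eq_zero.1 h0))

/-- Taylor expansions with constants uniform on `[a, b]`. -/
theorem taylor (h : Profile a b U U₁ U₂ U₃) : ∃ L > 0, ∀ y₀ ∈ Icc a b, ∀ y ∈ Icc a b,
    |U₂ y - U₂ y₀| ≤ L * |y - y₀| ∧
    |U₁ y - U₁ y₀ - U₂ y₀ * (y - y₀)| ≤ L * |y - y₀| ^ 2 ∧
    |U y - U y₀ - U₁ y₀ * (y - y₀) - U₂ y₀ * (y - y₀) ^ 2 / 2| ≤ L * |y - y₀| ^ 3 ∧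
    |U₂ y - U₂ y₀ - U₃ y₀ * (y - y₀)| ≤ L * (|y - y₀| * √|y - y₀|) := by
  obtain ⟨M, hM⟩ := isCompact_Icc.exists_bound_of_continuousOn (s := Icc a b)
    h.continuous₃.continuousOn
  obtain ⟨H, hH⟩ := h.holder
  set L := max (max M H) 1
  have hML : M ≤ L := (le_max_left _ _).trans (le_max_left _ _)
  have hHL : H ≤ L := (le_max_right _ _).trans (le_max_left _ _)
  have hL : 0 < L := one_pos.trans_le (le_max_right _ _)
  refine ⟨L, hL, ?_⟩
  have T₂ : ∀ y₀ ∈ Icc a b, ∀ y ∈ Icc a b, |U₂ y - U₂ y₀| ≤ L * |y - y₀| := by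
    intro y₀ hy₀ y hy
    refine abs_le_mul_of_abs_deriv_le (f := fun y => U₂ y - U₂ y₀) (f' := U₃)
      (fun z => (h.hasDerivAt₂ z).sub_const _) (sub_self _) fun z hz => ?_
    exact (hM z (uIcc_subset_Icc hy₀ hy hz)).trans hML
  have T₁ : ∀ y₀ ∈ Icc a b, ∀ y ∈ Icc a b,
      |U₁ y - U₁ y₀ - U₂ y₀ * (y - y₀)| ≤ L * |y - y₀| ^ 2 := by
    intro y₀ hy₀ y hy
    rw [pow_two, ← mul_assoc]
    refine abs_le_mul_of_abs_deriv_le (f := fun y => U₁ y - U₁ y₀ - U₂ y₀ * (y - y₀))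
      (f' := fun y => U₂ y - U₂ y₀) (fun z => ?_) (by simp) fun z hz => ?_
    · exact (((h.hasDerivAt₁ z).sub_const (U₁ y₀)).sub
        (((hasDerivAt_id z).sub_const y₀).const_mul (U₂ y₀))).congr_deriv (by simp)
    · exact (T₂ y₀ hy₀ z (uIcc_subset_Icc hy₀ hy hz)).trans
        (mul_le_mul_of_nonneg_left (abs_sub_left_of_mem_uIcc hz) hL.le)
  refine fun y₀ hy₀ y hy => ⟨T₂ y₀ hy₀ y hy, T₁ y₀ hy₀ y hy, ?_, ?_⟩
  · rw [show L * |y - y₀| ^ 3 = L * |y - y₀| ^ 2 * |y - y₀| by ring]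
    refine abs_le_mul_of_abs_deriv_le
      (f := fun y => U y - U y₀ - U₁ y₀ * (y - y₀) - U₂ y₀ * (y - y₀) ^ 2 / 2)
      (f' := fun y => U₁ y - U₁ y₀ - U₂ y₀ * (y - y₀)) (fun z => ?_) (by ring) fun z hz => ?_
    · have h1 : HasDerivAt (fun y => y - y₀) 1 z := (hasDerivAt_id z).sub_const y₀
      refine ((((h.hasDerivAt₀ z).sub_const (U y₀)).sub (h1.const_mul (U₁ y₀))).sub
        (((h1.pow 2).const_mul (U₂ y₀)).div_const 2)).congr_deriv ?_
      push_cast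
      ring
    · exact (T₁ y₀ hy₀ z (uIcc_subset_Icc hy₀ hy hz)).trans
        (mul_le_mul_of_nonneg_left (pow_le_pow_left₀ (abs_nonneg _)
          (abs_sub_left_of_mem_uIcc hz) 2) hL.le)
  · rw [mul_comm |y - y₀|, ← mul_assoc]
    refine abs_le_mul_of_abs_deriv_le (f := fun y => U₂ y - U₂ y₀ - U₃ y₀ * (y - y₀))
      (f' := fun y => U₃ y - U₃ y₀) (fun z => ?_) (by simp) fun z hz => ?_
    · exact (((h.hasDerivAt₂ z).sub_const (U₂ y₀)).sub
        (((hasDerivAt_id z).sub_const y₀).const_mul (U₃ y₀))).congr_deriv (by simp)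
    · refine (hH y₀ hy₀ z (uIcc_subset_Icc hy₀ hy hz)).trans ?_
      exact mul_le_mul hHL (Real.sqrt_le_sqrt (abs_sub_left_of_mem_uIcc hz)) (Real.sqrt_nonneg _)
        hL.le

/-- At a critical minimum point, possibly an endpoint, the second derivative is positive. -/
theorem snd_deriv_pos (h : Profile a b U U₁ U₂ U₃) (hab : a < b) {m : ℝ}
    (hm : ∀ y ∈ Icc a b, m ≤ U y) {y₀ : ℝ} (hy₀ : y₀ ∈ Icc a b) (hU : U y₀ = m)
    (hU₁ : U₁ y₀ = 0) : 0 < U₂ y₀ := by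
  obtain ⟨L, hL, T⟩ := h.taylor
  refine lt_of_le_of_ne ?_ (h.nondegenerate y₀ hy₀ hU₁).symm
  by_contra! hneg
  -- Choose a nearby point, on a side lying in the interval, where the cubic remainder is less than
  -- half of the negative quadratic term's coefficient allows; there `U` would fall below `m`.
  obtain ⟨y, hy, hne, hd⟩ : ∃ y ∈ Icc a b, 0 < |y - y₀| ∧ 2 * L * |y - y₀| < -U₂ y₀ := by
    have hε : 0 < -U₂ y₀ / (4 * L) := by have := neg_pos.2 hneg; positivity
    have key : ∀ x, 0 < x → x ≤ -U₂ y₀ / (4 * L) → 2 * L * x < -U₂ y₀ := fun x _ hx => by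
      rw [le_div_iff₀ (by positivity)] at hx
      linarith
    rcases lt_or_ge y₀ b with hb | hb
    · have h0 : 0 < min (b - y₀) (-U₂ y₀ / (4 * L)) := lt_min (sub_pos.2 hb) hε
      refine ⟨y₀ + min (b - y₀) (-U₂ y₀ / (4 * L)), ⟨by linarith [hy₀.1],
        by linarith [min_le_left (b - y₀) (-U₂ y₀ / (4 * L))]⟩, ?_, ?_⟩
      · rw [add_sub_cancel_left, abs_of_pos h0]; exact h0
      · rw [add_sub_cancel_left, abs_of_pos h0]
        exact key _ h0 (min_le_right _ _)
    · have hay : a < y₀ := hab.trans_le hb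
      have h0 : 0 < min (y₀ - a) (-U₂ y₀ / (4 * L)) := lt_min (sub_pos.2 hay) hε
      refine ⟨y₀ - min (y₀ - a) (-U₂ y₀ / (4 * L)),
        ⟨by linarith [min_le_left (y₀ - a) (-U₂ y₀ / (4 * L))], by linarith [hy₀.2]⟩, ?_, ?_⟩
      · rw [sub_sub_cancel_left, abs_neg, abs_of_pos h0]; exact h0
      · rw [sub_sub_cancel_left, abs_neg, abs_of_pos h0]
        exact key _ h0 (min_le_right _ _)
  have h1 := (abs_le.1 (T y₀ hy₀ y hy).2.2.1).2
  rw [hU₁, hU, ← sq_abs (y - y₀)] at h1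
  have h2 := hm y hy
  have hsq : 0 < |y - y₀| ^ 2 := by positivity
  nlinarith [mul_lt_mul_of_pos_right hd hsq]

/-- The Rayleigh-Kuo potential is bounded below by the Hardy potential near a minimum point which
is not critical, or at which `β ≤ (9 / 8) u''`. -/
theorem hardy_le_potential (h : Profile a b U U₁ U₂ U₃) (hab : a < b) {m β : ℝ}
    (hm : ∀ y ∈ Icc a b, m ≤ U y) {y₀ : ℝ} (hy₀ : y₀ ∈ Icc a b) (hU : U y₀ = m)
    (hβ : U₁ y₀ = 0 → β ≤ 9 / 8 * U₂ y₀) :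
    ∃ r > 0, ∃ K > 0, ∀ c < m, ∀ y ∈ Icc a b, 0 < |y - y₀| → |y - y₀| < r →
      -(1 / (4 * |y - y₀| ^ 2)) - K / |y - y₀| - K ≤ (U₂ y - β) / (U y - c) := by
  obtain ⟨L, hL, T⟩ := h.taylor
  -- Clearing the denominator removes `c`: the bound at `c = m` implies all others because `U y - c`
  -- only grows as `c` decreases.
  suffices H : ∃ r > 0, ∃ K > 0, ∀ y ∈ Icc a b, 0 < |y - y₀| → |y - y₀| < r →
      0 < U y - m ∧
      -((1 / (4 * |y - y₀| ^ 2) + K / |y - y₀| + K) * (U y - m)) ≤ U₂ y - β by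
    obtain ⟨r, hr, K, hK, H⟩ := H
    refine ⟨r, hr, K, hK, fun c hc y hy h0 hyr => ?_⟩
    obtain ⟨h1, h2⟩ := H y hy h0 hyr
    rw [le_div_iff₀ (by linarith)]
    have h3 : 0 ≤ 1 / (4 * |y - y₀| ^ 2) + K / |y - y₀| + K := by positivity
    nlinarith [mul_le_mul_of_nonneg_left (show U y - m ≤ U y - c by linarith) h3]
  by_cases hU₁ : U₁ y₀ = 0
  · have hκ := h.snd_deriv_pos hab hm hy₀ hU hU₁
    have hβ' := hβ hU₁
    set κ := U₂ y₀
    refine ⟨κ / (4 * L), by positivity, 5 * L / κ, by positivity, fun y hy h0 hyr => ?_⟩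
    obtain ⟨t2, -, t0, -⟩ := T y₀ hy₀ y hy
    rw [hU₁, hU, ← sq_abs (y - y₀)] at t0
    set x := |y - y₀|
    have t0' := (abs_le.1 t0).1
    have t2' := (abs_le.1 t2).1
    rw [lt_div_iff₀ (by positivity)] at hyr
    have hx2 : 0 < x ^ 2 := by positivity
    have h4 : L * x ^ 3 ≤ κ / 4 * x ^ 2 := by nlinarith
    have hlow : κ * x ^ 2 / 2 - L * x ^ 3 ≤ U y - m := by linarith
    refine ⟨by nlinarith, ?_⟩
    have h5 : (1 / (4 * x ^ 2) + 5 * L / κ / x) * (κ * x ^ 2 / 2 - L * x ^ 3) ≤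
        (1 / (4 * x ^ 2) + 5 * L / κ / x + 5 * L / κ) * (U y - m) := by
      have hD : 0 ≤ U y - m := by nlinarith
      have : (1 / (4 * x ^ 2) + 5 * L / κ / x) * (κ * x ^ 2 / 2 - L * x ^ 3) ≤
        (1 / (4 * x ^ 2) + 5 * L / κ / x) * (U y - m) := by gcongr
      have h6 : 0 ≤ 5 * L / κ * (U y - m) := by positivity
      linarith
    -- The term `κ / 8` absorbs `κ - β ≥ -κ / 8`, which is where 9/8 is used. The slope `5 L / κ`
    -- leaves `9/4 L x` minus at most `5/4 L x`, just enough for the error `L x` of `U₂`.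
    have h6 : (1 / (4 * x ^ 2) + 5 * L / κ / x) * (κ * x ^ 2 / 2 - L * x ^ 3) =
        κ / 8 + (9 / 4 * L * x - 5 * L * x * (L * x) / κ) := by
      field_simp
      ring
    have h7 : 5 * L * x * (L * x) / κ ≤ 5 / 4 * L * x := by
      rw [div_le_iff₀ hκ]
      have : 0 < L * x := by positivity
      nlinarith
    linarith
  · obtain ⟨M, hM⟩ := isCompact_Icc.exists_bound_of_continuousOn (s := Icc a b)
      (h.continuous₂.sub (continuous_const (y := β))).continuousOn
    have hM' : ∀ y ∈ Icc a b, |U₂ y - β| ≤ M := hM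
    have hM0 : 0 ≤ M := (abs_nonneg _).trans (hM' y₀ hy₀)
    obtain ⟨r, hr, hball⟩ := Metric.eventually_nhds_iff.1
      ((hasDerivAt_iff_tendsto_slope.1 (h.hasDerivAt₀ y₀)).abs.eventually
        (lt_mem_nhds (half_lt_self (abs_pos.2 hU₁))) |> eventually_nhdsWithin_iff.1)
    have hk : 0 < |U₁ y₀| / 2 := half_pos (abs_pos.2 hU₁)
    set k := |U₁ y₀| / 2
    refine ⟨r, hr, M / k + 1, by positivity, fun y hy h0 hyr => ?_⟩
    have hs := hball (y := y) (by rwa [Real.dist_eq]) (abs_pos.1 h0 |> sub_ne_zero.1)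
    rw [slope_def_field, abs_div, lt_div_iff₀ h0, hU, abs_of_nonneg (sub_nonneg.2 (hm y hy))] at hs
    set x := |y - y₀|
    have hpos : 0 < U y - m := lt_trans (by positivity) hs
    refine ⟨hpos, ?_⟩
    have h1 : M ≤ (M / k + 1) / x * (k * x) := by
      have : (M / k + 1) / x * (k * x) = M + k := by field_simp
      linarith
    have h2 : (M / k + 1) / x * (k * x) ≤ (M / k + 1) / x * (U y - m) := by gcongr
    have h3 : 0 ≤ 1 / (4 * x ^ 2) * (U y - m) := by positivity
    have h4 : 0 ≤ (M / k + 1) * (U y - m) := by positivity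
    have h5 := (abs_le.1 (hM' y hy)).1
    linarith

end Profile

/-! ### The logarithmic singularity at an interior minimum. -/

/-- For `D < 1` use `log z ≤ z` with `z = D^(-1/8)`: the square is at most `64 D^(-1/4)`, and `D ≥ e
x²` turns this into a multiple of `x^(-1/2)`, integrable uniformly in `D`. -/
theorem sq_log_le {D B e x : ℝ} (he : 0 < e) (hx : 0 < x) (hlow : e * x ^ 2 ≤ D) (hB : D ≤ B) :
    Real.log D ^ 2 ≤ Real.log B ^ 2 + 64 * √√e⁻¹ / √x := by
  have hD : 0 < D := lt_of_lt_of_le (by positivity) hlow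
  rcases le_or_gt 1 D with h1 | h1
  · have h0 := Real.log_nonneg h1
    have hl := Real.log_le_log hD hB
    have : 0 ≤ 64 * √√e⁻¹ / √x := by positivity
    nlinarith
  · set z := √√√D⁻¹
    have hz : 0 < z := by positivity
    have hlog : Real.log z = -Real.log D / 8 := by
      rw [Real.log_sqrt (by positivity), Real.log_sqrt (by positivity),
        Real.log_sqrt (by positivity), Real.log_inv]
      ring
    have hneg : Real.log D < 0 := Real.log_neg hD h1
    have hle : Real.log z ≤ z := (Real.log_le_sub_one_of_pos hz).trans (by linarith)
    have hz2 : z ^ 2 = √√D⁻¹ := Real.sq_sqrt (by positivity)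
    have h2 : √√D⁻¹ ≤ √√(e * x ^ 2)⁻¹ :=
      Real.sqrt_le_sqrt (Real.sqrt_le_sqrt (inv_anti₀ (by positivity) hlow))
    have h3 : √√(e * x ^ 2)⁻¹ = √√e⁻¹ / √x := by
      rw [mul_inv, Real.sqrt_mul (by positivity), ← inv_pow, Real.sqrt_sq (by positivity),
        Real.sqrt_mul (by positivity), Real.sqrt_inv x, div_eq_mul_inv]
    rw [h3] at h2
    have h4 : Real.log D ^ 2 = 64 * Real.log z ^ 2 := by rw [hlog]; ring
    have h5 : Real.log z ^ 2 ≤ z ^ 2 := by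
      have : 0 ≤ Real.log z := by rw [hlog]; linarith
      nlinarith
    rw [h4, mul_div_assoc]
    nlinarith [sq_nonneg (Real.log B)]

/-- Since `√` vanishes on negative numbers, `√x - √(-x)` is `√|x|` with the sign of `x`, a
continuous primitive of the integrable singularity on both sides of 0. -/
theorem hasDerivAt_sqrt_sub_sqrt_neg {x : ℝ} (hx : x ≠ 0) :
    HasDerivAt (fun x => √x - √(-x)) (1 / (2 * √|x|)) x := by
  have h := (Real.hasDerivAt_sqrt hx).sub
    ((Real.hasDerivAt_sqrt (neg_ne_zero.2 hx)).comp x (hasDerivAt_neg x))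
  refine h.congr_deriv ?_
  rcases lt_or_gt_of_ne hx with h | h
  · rw [abs_of_neg h, Real.sqrt_eq_zero_of_nonpos h.le]
    simp
  · rw [abs_of_pos h, Real.sqrt_eq_zero_of_nonpos (neg_nonpos.2 h.le)]
    simp

theorem sq_sqrt_sub_sqrt_neg (x : ℝ) : (√x - √(-x)) ^ 2 = |x| := by
  rcases le_total x 0 with h | h
  · rw [abs_of_nonpos h, Real.sqrt_eq_zero_of_nonpos h, zero_sub, neg_sq,
      Real.sq_sqrt (neg_nonneg.2 h)]
  · rw [abs_of_nonneg h, Real.sqrt_eq_zero_of_nonpos (neg_nonpos.2 h), sub_zero, Real.sq_sqrt h]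

/-- Uniform bound for potentials with the logarithmic singularity `A D' / D`, where
`D ≥ e (y - y₀)²`, up to an integrable error: the principal part integrates to a bounded power of
a logarithm, because the window contains both sides of `y₀`. -/
theorem FormBound.of_log_deriv {a b : ℝ} {I : Set ℝ} {q D : ℝ → ℝ → ℝ} {D₁ : ℝ → ℝ}
    {s t y₀ A K e B : ℝ} (hs : s < y₀) (ht : y₀ < t) (hs1 : y₀ - s ≤ 1) (ht1 : t - y₀ ≤ 1)
    (he : 0 < e) (hD : ∀ c y, HasDerivAt (D c) (D₁ y) y)
    (hDpos : ∀ c ∈ I, 0 < D c y₀)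
    (hDlow : ∀ c ∈ I, ∀ y ∈ Icc s t, e * |y - y₀| ^ 2 ≤ D c y)
    (hDB : ∀ c ∈ I, ∀ y ∈ Icc s t, D c y ≤ B)
    (hq : ∀ c ∈ I, ContinuousOn (q c) (Icc s t))
    (hle : ∀ c ∈ I, ∀ y ∈ Icc s t, y ≠ y₀ → A * D₁ y / D c y - K / √|y - y₀| ≤ q c y) :
    FormBound a b I q s t := by
  set N₀ := Real.log B ^ 2
  set N := 64 * √√e⁻¹
  -- `K₂` covers the `1 / √x` error of the potential and the one that `log²` contributes to `w²`;
  -- `Ξ` bounds the nonlinear part of `w`, and `Λ` is so large that `w` has the right signs at `s`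
  -- and `t`.
  set K₂ := K + 3 * A ^ 2 * N
  let Ξ : ℝ → ℝ := fun x => |A| * (1 + N₀ + N / √x) + 2 * |K₂| * √x
  obtain ⟨Λ, hΛt, hΛs⟩ : ∃ Λ, Ξ (t - y₀) ≤ Λ * (t - y₀) ∧ Ξ (y₀ - s) ≤ Λ * (y₀ - s) :=
    ⟨max (Ξ (t - y₀) / (t - y₀)) (Ξ (y₀ - s) / (y₀ - s)),
      (div_le_iff₀ (sub_pos.2 ht)).1 (le_max_left _ _),
      (div_le_iff₀ (sub_pos.2 hs)).1 (le_max_right _ _)⟩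
  set C := Λ + 3 * A ^ 2 * N₀ + 12 * K₂ ^ 2 + 3 * Λ ^ 2
  refine ⟨C, fun c hc φ φ₁ hφ hφ₁ _ _ => ?_⟩
  have hφc : Continuous φ := continuous_iff_continuousAt.2 fun y => (hφ y).continuousAt
  have hDc : Continuous (D c) := continuous_iff_continuousAt.2 fun y => (hD c y).continuousAt
  have hDp : ∀ y ∈ Icc s t, 0 < D c y := fun y hy => by
    rcases eq_or_ne y y₀ with rfl | hne
    · exact hDpos c hc
    · have : 0 < |y - y₀| := abs_pos.2 (sub_ne_zero.2 hne)
      exact lt_of_lt_of_le (by positivity) (hDlow c hc y hy)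
  -- Primitives of the principal part and of the `1 / √x` error, plus a linear term. For each `c`
  -- this is continuous at `y₀`, because `D c y₀ > 0`.
  let w : ℝ → ℝ := fun y =>
    A * Real.log (D c y) - 2 * K₂ * (√(y - y₀) - √(-(y - y₀))) + Λ * (y - y₀)
  have hlog : ∀ y ∈ Icc s t, y ≠ y₀ → Real.log (D c y) ^ 2 ≤ N₀ + N / √|y - y₀| := fun y hy hne =>
    sq_log_le he (abs_pos.2 (sub_ne_zero.2 hne)) (hDlow c hc y hy) (hDB c hc y hy)
  have hw : ∀ y ∈ Icc s t, y ≠ y₀ →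
      HasDerivAt w (A * (D₁ y / D c y) - 2 * K₂ * (1 / (2 * √|y - y₀|)) + Λ) y := fun y hy hne => by
    have hid : HasDerivAt (fun y => y - y₀) 1 y := (hasDerivAt_id y).sub_const y₀
    have h1 := ((hD c y).log (hDp y hy).ne').const_mul A
    have h2 := ((hasDerivAt_sqrt_sub_sqrt_neg (sub_ne_zero.2 hne)).comp y hid).const_mul (2 * K₂)
    exact ((h1.sub h2).add (hid.const_mul Λ)).congr_deriv (by ring)
  have hwc : ContinuousOn w (Icc s t) := by
    have h1 : ContinuousOn (fun y => Real.log (D c y)) (Icc s t) :=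
      hDc.continuousOn.log fun y hy => (hDp y hy).ne'
    fun_prop
  have hF : ContinuousOn (fun y => w y * φ y ^ 2) (Icc s t) := by fun_prop
  have hric : ∀ y ∈ Icc s t, y ≠ y₀ →
      A * (D₁ y / D c y) - 2 * K₂ * (1 / (2 * √|y - y₀|)) + Λ + w y ^ 2 ≤ q c y + C := by
    intro y hy hne
    have hx : 0 < |y - y₀| := abs_pos.2 (sub_ne_zero.2 hne)
    have hx1 : |y - y₀| ≤ 1 := abs_le.2 ⟨by linarith [hy.1], by linarith [hy.2]⟩
    have h1 := hle c hc y hy hne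
    have h2 := mul_le_mul_of_nonneg_left (hlog y hy hne) (show 0 ≤ 3 * A ^ 2 by positivity)
    have h3 := sq_sqrt_sub_sqrt_neg (y - y₀)
    have h4 : (y - y₀) ^ 2 ≤ 1 := by rw [← sq_abs]; nlinarith
    have h5 : w y ^ 2 ≤ 3 * A ^ 2 * Real.log (D c y) ^ 2 +
        12 * K₂ ^ 2 * (√(y - y₀) - √(-(y - y₀))) ^ 2 + 3 * Λ ^ 2 * (y - y₀) ^ 2 := by
      have key : ∀ p₁ p₂ p₃ : ℝ, (p₁ - p₂ + p₃) ^ 2 ≤ 3 * p₁ ^ 2 + 3 * p₂ ^ 2 + 3 * p₃ ^ 2 :=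
        fun p₁ p₂ p₃ => by
          nlinarith [sq_nonneg (p₁ + p₂), sq_nonneg (p₁ - p₃), sq_nonneg (p₂ + p₃)]
      refine (key _ _ _).trans (le_of_eq ?_)
      ring
    rw [h3] at h5
    have h6 : 12 * K₂ ^ 2 * |y - y₀| ≤ 12 * K₂ ^ 2 := mul_le_of_le_one_right (by positivity) hx1
    have h7 : 3 * Λ ^ 2 * (y - y₀) ^ 2 ≤ 3 * Λ ^ 2 := mul_le_of_le_one_right (by positivity) h4
    have h8 : 2 * K₂ * (1 / (2 * √|y - y₀|)) = K / √|y - y₀| + 3 * A ^ 2 * (N / √|y - y₀|) := by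
      simp only [K₂]
      field_simp
    rw [h8, ← mul_div_assoc]
    simp only [C]
    linarith
  have hlb : ∀ y ∈ Icc s t, y ≠ y₀ →
      |A * Real.log (D c y) - 2 * K₂ * (√(y - y₀) - √(-(y - y₀)))| ≤ Ξ |y - y₀| := by
    intro y hy hne
    have h1 := hlog y hy hne
    have h2 : |Real.log (D c y)| ≤ 1 + N₀ + N / √|y - y₀| := by
      rw [← sq_abs] at h1
      nlinarith [sq_nonneg (|Real.log (D c y)| - 1), sq_nonneg (|Real.log (D c y)|)]
    have h3 : |√(y - y₀) - √(-(y - y₀))| = √|y - y₀| := by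
      rw [← sq_sqrt_sub_sqrt_neg (y - y₀), Real.sqrt_sq_eq_abs]
    refine (abs_sub _ _).trans ?_
    rw [abs_mul, abs_mul, abs_mul, h3, abs_two]
    have := mul_le_mul_of_nonneg_left h2 (abs_nonneg A)
    simp only [Ξ]
    linarith
  have hqL := (hq c hc).mono (Icc_subset_Icc_right ht.le : Icc s y₀ ⊆ Icc s t)
  have hqR := (hq c hc).mono (Icc_subset_Icc_left hs.le : Icc y₀ t ⊆ Icc s t)
  -- The square roots are not differentiable at `y₀`, so the inequality is used on each side; the
  -- boundary terms at `y₀` cancel, which matters because `log (D c y₀)` need not be bounded in `c`.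
  have hL := riccati_le_integral hs.le (φ := φ) (φ₁ := φ₁) (p := fun y => q c y + C) (w := w)
    (F := fun y => w y * φ y ^ 2) (fun y _ => hφ y) (continuousOn_form hqL hφ hφ₁)
    (fun y hy => hw y ⟨hy.1.le, hy.2.le.trans ht.le⟩ hy.2.ne)
    (hF.mono (Icc_subset_Icc_right ht.le)) (fun y _ => rfl)
    (fun y hy => hric y ⟨hy.1.le, hy.2.le.trans ht.le⟩ hy.2.ne)
  have hR := riccati_le_integral ht.le (φ := φ) (φ₁ := φ₁) (p := fun y => q c y + C) (w := w)
    (F := fun y => w y * φ y ^ 2) (fun y _ => hφ y) (continuousOn_form hqR hφ hφ₁)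
    (fun y hy => hw y ⟨hs.le.trans hy.1.le, hy.2.le⟩ hy.1.ne')
    (hF.mono (Icc_subset_Icc_left hs.le)) (fun y _ => rfl)
    (fun y hy => hric y ⟨hs.le.trans hy.1.le, hy.2.le⟩ hy.1.ne')
  have hwt : 0 ≤ w t := by
    have h1 := hlb t ⟨(hs.trans ht).le, le_rfl⟩ ht.ne'
    rw [abs_of_pos (sub_pos.2 ht)] at h1
    have := (abs_le.1 h1).1
    simp only [w]
    linarith
  have hws : w s ≤ 0 := by
    have h1 := hlb s ⟨le_rfl, (hs.trans ht).le⟩ hs.ne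
    rw [abs_of_neg (sub_neg.2 hs), neg_sub] at h1
    have := (abs_le.1 h1).2
    simp only [w]
    rw [neg_sub]
    linarith
  have hint : ∀ x y, s ≤ x → x ≤ y → y ≤ t →
      IntervalIntegrable (fun y => φ₁ y ^ 2 + (q c y + C) * φ y ^ 2) volume x y :=
    fun x y hx hxy hy => by
      apply ContinuousOn.intervalIntegrable
      rw [uIcc_of_le hxy]
      exact continuousOn_form ((hq c hc).mono (Icc_subset_Icc hx hy)) hφ hφ₁
  rw [← intervalIntegral.integral_add_adjacent_intervals (hint s y₀ le_rfl hs.le ht.le)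
    (hint y₀ t hs.le ht.le le_rfl)]
  have h1 := mul_nonneg hwt (sq_nonneg (φ t))
  have h2 := mul_nonpos_of_nonpos_of_nonneg hws (sq_nonneg (φ s))
  linarith

namespace Profile

variable {a b : ℝ} {U U₁ U₂ U₃ : ℝ → ℝ}

/-- Local bound at an interior minimum point with `β ≤ u''`. -/
theorem formBound_interior (h : Profile a b U U₁ U₂ U₃) (hab : a < b) {m β : ℝ}
    (hm : ∀ y ∈ Icc a b, m ≤ U y) {y₀ : ℝ} (hy₀ : y₀ ∈ Icc a b) (hU : U y₀ = m)
    (hU₁ : U₁ y₀ = 0) (hβ : β ≤ U₂ y₀) :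
    ∃ r > 0, ∀ s t, a ≤ s → s < y₀ → y₀ < t → t ≤ b → y₀ - r < s → t < y₀ + r →
      FormBound a b (Ioo (m - 1) m) (fun c y => (U₂ y - β) / (U y - c)) s t := by
  obtain ⟨L, hL, T⟩ := h.taylor
  have hκ := h.snd_deriv_pos hab hm hy₀ hU hU₁
  obtain ⟨M, hM⟩ := isCompact_Icc.exists_bound_of_continuousOn (s := Icc a b)
    h.continuous₀.continuousOn
  set κ := U₂ y₀ with hκdef
  -- With this slope `A U₁` matches the linear Taylor term of `U₂` at `y₀`. The remaining error
  -- `O(x^(3/2))` divided by `U - c ≥ κ x² / 4` is `O(1 / √x)`.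
  set A := U₃ y₀ / κ
  refine ⟨min 1 (κ / (4 * L)), lt_min one_pos (by positivity), fun s t has hs ht htb hsr htr => ?_⟩
  have hmem : ∀ y ∈ Icc s t, y ∈ Icc a b := fun y hy => ⟨has.trans hy.1, hy.2.trans htb⟩
  have hxr : ∀ y ∈ Icc s t, |y - y₀| < min 1 (κ / (4 * L)) := fun y hy =>
    abs_lt.2 ⟨by linarith [hy.1], by linarith [hy.2]⟩
  have hlow : ∀ y ∈ Icc s t, κ / 4 * |y - y₀| ^ 2 ≤ U y - m := fun y hy => by
    have t0 := (T y₀ hy₀ y (hmem y hy)).2.2.1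
    rw [hU₁, hU, ← sq_abs (y - y₀), ← hκdef] at t0
    have t0' := (abs_le.1 t0).1
    have hx := (hxr y hy).trans_le (min_le_right _ _)
    rw [lt_div_iff₀ (by positivity)] at hx
    have hx2 : 0 ≤ |y - y₀| ^ 2 := by positivity
    nlinarith
  have hr1 : min 1 (κ / (4 * L)) ≤ 1 := min_le_left _ _
  refine FormBound.of_log_deriv (D := fun c y => U y - c) (D₁ := U₁) (A := A) (e := κ / 4)
    (B := M - m + 1) (K := L * (1 + |A|) / (κ / 4)) hs ht (by linarith) (by linarith) (by positivity)
    (fun c y => (h.hasDerivAt₀ y).sub_const c) (fun c hc => by rw [hU]; linarith [hc.2])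
    (fun c hc y hy => (hlow y hy).trans (by linarith [hc.2]))
    (fun c hc y hy => by linarith [hc.1, (abs_le.1 (hM y (hmem y hy))).2])
    (fun c hc => ?_) (fun c hc y hy hne => ?_)
  · refine (h.continuous₂.sub continuous_const).continuousOn.div
      (h.continuous₀.sub continuous_const).continuousOn fun y hy => ?_
    have := hm y (hmem y hy)
    exact (by linarith [hc.2] : 0 < U y - c).ne'
  · have hx : 0 < |y - y₀| := abs_pos.2 (sub_ne_zero.2 hne)
    obtain ⟨-, t1, -, t3⟩ := T y₀ hy₀ y (hmem y hy)
    rw [hU₁, sub_zero] at t1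
    have hx1 : |y - y₀| ≤ 1 := ((hxr y hy).trans_le hr1).le
    have hD : κ / 4 * |y - y₀| ^ 2 ≤ U y - c := (hlow y hy).trans (by linarith [hc.2])
    set x := |y - y₀|
    have hsx : 0 < √x := Real.sqrt_pos.2 hx
    have hss : √x * √x = x := Real.mul_self_sqrt hx.le
    have hsx1 : √x ≤ 1 := Real.sqrt_le_one.2 hx1
    have hDpos : 0 < U y - c := lt_of_lt_of_le (by positivity) hD
    have hAU : |A * (U₁ y - κ * (y - y₀))| ≤ |A| * (L * x ^ 2) := by
      rw [abs_mul]
      exact mul_le_mul_of_nonneg_left t1 (abs_nonneg A)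
    have hAκ : A * κ = U₃ y₀ := div_mul_cancel₀ _ hκ.ne'
    have h1 := (abs_le.1 hAU).2
    have h2 := (abs_le.1 t3).1
    have h3 : x ^ 2 ≤ x * √x := by
      rw [pow_two]
      refine mul_le_mul_of_nonneg_left ?_ hx.le
      nlinarith
    have h4 : A * U₁ y - L * (1 + |A|) * (x * √x) ≤ U₂ y - β := by
      have e1 : A * (U₁ y - κ * (y - y₀)) = A * U₁ y - U₃ y₀ * (y - y₀) := by
        rw [← hAκ]; ring
      rw [e1] at h1
      have h5 := mul_le_mul_of_nonneg_left h3 (show 0 ≤ |A| * L by positivity)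
      nlinarith
    have h5 : L * (1 + |A|) * (x * √x) ≤ L * (1 + |A|) / (κ / 4) / √x * (U y - c) := by
      have e2 : L * (1 + |A|) * (x * √x) =
          L * (1 + |A|) / (κ / 4) / √x * (κ / 4 * x ^ 2) := by
        have : x ^ 2 = x * √x * √x := by rw [mul_assoc, hss, pow_two]
        rw [this]
        field_simp
      rw [e2]
      exact mul_le_mul_of_nonneg_left hD (by positivity)
    rw [le_div_iff₀ hDpos, sub_mul, div_mul_cancel₀ _ hDpos.ne']
    linarith

end Profile

/-! ### Global bound, and divergence beyond the threshold. -/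

theorem FormBound.union {a b : ℝ} {I J : Set ℝ} {q : ℝ → ℝ → ℝ} {s t : ℝ} (hst : s ≤ t)
    (hq : ∀ c ∈ I ∪ J, ContinuousOn (q c) (Icc s t)) (hI : FormBound a b I q s t)
    (hJ : FormBound a b J q s t) : FormBound a b (I ∪ J) q s t := by
  obtain ⟨C, hC⟩ := hI
  obtain ⟨C', hC'⟩ := hJ
  refine ⟨max C C', fun c hc φ φ₁ hφ hφ₁ ha hb => ?_⟩
  have hi : ∀ K, IntervalIntegrable (fun y => φ₁ y ^ 2 + (q c y + K) * φ y ^ 2) volume s t :=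
    fun K => by
      apply ContinuousOn.intervalIntegrable
      rw [uIcc_of_le hst]
      exact continuousOn_form (hq c hc) hφ hφ₁
  have hmono : ∀ K ≤ max C C', ∫ y in s..t, (φ₁ y ^ 2 + (q c y + K) * φ y ^ 2) ≤
      ∫ y in s..t, (φ₁ y ^ 2 + (q c y + max C C') * φ y ^ 2) := fun K hK =>
    intervalIntegral.integral_mono_on hst (hi _) (hi _) fun y _ => by gcongr
  rcases hc with hc | hc
  · exact (hC c hc φ φ₁ hφ hφ₁ ha hb).trans (hmono _ (le_max_left _ _))
  · exact (hC' c hc φ φ₁ hφ hφ₁ ha hb).trans (hmono _ (le_max_right _ _))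

namespace Profile

variable {a b : ℝ} {U U₁ U₂ U₃ : ℝ → ℝ}

theorem continuousOn_potential (h : Profile a b U U₁ U₂ U₃) {β c : ℝ}
    (hc : ∀ y ∈ Icc a b, U y ≠ c) : ContinuousOn (fun y => (U₂ y - β) / (U y - c)) (Icc a b) :=
  (h.continuous₂.sub continuous_const).continuousOn.div
    (h.continuous₀.sub continuous_const).continuousOn fun y hy => sub_ne_zero.2 (hc y hy)

/-- The quadratic forms of the Rayleigh-Kuo problems with `c` below the range of the profile are
uniformly bounded below. -/
theorem formBound (h : Profile a b U U₁ U₂ U₃) (hab : a < b) {m β : ℝ}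
    (hm : ∀ y ∈ Icc a b, m ≤ U y)
    (hcrit : ∀ y ∈ Icc a b, U₁ y = 0 → U y = m → β ≤ 9 / 8 * U₂ y)
    (hint : ∀ y ∈ Ioo a b, U y = m → β ≤ U₂ y) :
    FormBound a b (Iio m) (fun c y => (U₂ y - β) / (U y - c)) a b := by
  have hq : ∀ c < m, ContinuousOn (fun y => (U₂ y - β) / (U y - c)) (Icc a b) := fun c hc =>
    h.continuousOn_potential fun y hy => (hc.trans_le (hm y hy)).ne'
  obtain ⟨M, hM⟩ := isCompact_Icc.exists_bound_of_continuousOn (s := Icc a b)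
    (h.continuous₂.sub (continuous_const (y := β))).continuousOn
  have hM' : ∀ y ∈ Icc a b, |U₂ y - β| ≤ M := hM
  have hM0 : 0 ≤ M := (abs_nonneg _).trans (hM' a (left_mem_Icc.2 hab.le))
  have hfar : ∀ d > 0, ∀ c, ∀ y ∈ Icc a b, d ≤ U y - c → -(M / d) ≤ (U₂ y - β) / (U y - c) := by
    intro d hd c y hy hdc
    have hpos : 0 < U y - c := hd.trans_le hdc
    rw [le_div_iff₀ hpos]
    have h1 : M ≤ M / d * (U y - c) := by
      rw [div_mul_eq_mul_div, le_div_iff₀ hd]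
      exact mul_le_mul_of_nonneg_left hdc hM0
    linarith [(abs_le.1 (hM' y hy)).1]
  -- For `c ≤ m - 1` the denominator is at least 1; for the other `c` it is bounded above, as the
  -- logarithmic estimate requires.
  have hIio : Iio m = Iic (m - 1) ∪ Ioo (m - 1) m := by
    ext c
    simp only [mem_Iio, mem_union, mem_Iic, mem_Ioo]
    constructor
    · intro hc
      rcases le_or_gt c (m - 1) with h | h
      exacts [Or.inl h, Or.inr ⟨h, hc⟩]
    · rintro (hc | hc)
      exacts [by linarith, hc.2]
  rw [hIio]
  refine FormBound.union hab.le (fun c hc => hq c (by rwa [← hIio] at hc))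
    (FormBound.of_le (C := M / 1) hab.le fun c hc y hy =>
      hfar 1 one_pos c y hy (by have := hm y hy; have : c ≤ m - 1 := hc; linarith)) ?_
  refine FormBound.of_local hab (fun c hc => hq c hc.2) fun y₀ hy₀ => ?_
  rcases (hm y₀ hy₀).eq_or_lt with hU | hU
  · by_cases hio : y₀ ∈ Ioo a b
    · have hU₁ : U₁ y₀ = 0 := by
        refine IsLocalMin.hasDerivAt_eq_zero ?_ (h.hasDerivAt₀ y₀)
        filter_upwards [Icc_mem_nhds hio.1 hio.2] with z hz
        rw [← hU]
        exact hm z hz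
      obtain ⟨r, hr, hP⟩ := h.formBound_interior hab hm hy₀ hU.symm hU₁ (hint y₀ hio hU.symm)
      refine ⟨r, hr, fun s t has hs ht htb hsr htr hs' ht' => ?_⟩
      exact hP s t has (hs'.resolve_right hio.1.ne') (ht'.resolve_right hio.2.ne) htb hsr htr
    · obtain ⟨r, hr, K, hK, hP⟩ := h.hardy_le_potential hab hm hy₀ hU.symm
        fun h0 => hcrit y₀ hy₀ h0 hU.symm
      have hend : y₀ = a ∨ y₀ = b := by
        by_contra! hne
        exact hio ⟨lt_of_le_of_ne hy₀.1 hne.1.symm, lt_of_le_of_ne hy₀.2 hne.2⟩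
      refine ⟨min r (min (1 / (2 * K)) (b - a)),
        lt_min hr (lt_min (by positivity) (sub_pos.2 hab)),
        fun s t has hs ht htb hsr htr hs' ht' => ?_⟩
      have hr1 : min r (min (1 / (2 * K)) (b - a)) ≤ r := min_le_left _ _
      have hr2 : min r (min (1 / (2 * K)) (b - a)) ≤ 1 / (2 * K) :=
        (min_le_right _ _).trans (min_le_left _ _)
      have hr3 : min r (min (1 / (2 * K)) (b - a)) ≤ b - a :=
        (min_le_right _ _).trans (min_le_right _ _)
      have hK2 : 2 * K * (1 / (2 * K)) = 1 := by field_simp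
      rcases hend with rfl | rfl
      · obtain rfl : s = y₀ := le_antisymm hs has
        refine FormBound.of_hardy_left (K := K) ht ?_
          (fun c hc => (hq c hc.2).mono (Icc_subset_Icc_right htb)) fun c hc y hy => ?_
        · rw [← hK2]
          exact mul_le_mul_of_nonneg_left (by linarith) (by positivity)
        · have := hP c hc.2 y ⟨hy.1.le, hy.2.trans htb⟩
          rw [abs_of_pos (sub_pos.2 hy.1)] at this
          exact this (sub_pos.2 hy.1) (by linarith [hy.2])
      · obtain rfl : t = y₀ := le_antisymm htb ht
        refine FormBound.of_hardy_right (K := K) hs ?_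
          (fun c hc => (hq c hc.2).mono (Icc_subset_Icc_left has)) fun c hc y hy => ?_
        · rw [← hK2]
          exact mul_le_mul_of_nonneg_left (by linarith) (by positivity)
        · have := hP c hc.2 y ⟨has.trans hy.1, hy.2.le⟩
          rw [abs_of_neg (sub_neg.2 hy.2), neg_sub] at this
          exact this (sub_pos.2 hy.2) (by linarith [hy.1])
  · obtain ⟨r, hr, hball⟩ := Metric.eventually_nhds_iff.1
      (h.continuous₀.continuousAt.eventually (lt_mem_nhds (show (m + U y₀) / 2 < U y₀ by linarith)))
    refine ⟨r, hr, fun s t has hs ht htb hsr htr _ _ => ?_⟩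
    have hd : 0 < (U y₀ - m) / 2 := by linarith
    refine FormBound.of_le (hs.trans ht) fun c hc y hy =>
      hfar _ hd c y ⟨has.trans hy.1, hy.2.trans htb⟩ ?_
    have := hball (y := y) (by
      rw [Real.dist_eq, abs_lt]
      exact ⟨by linarith [hy.1], by linarith [hy.2]⟩)
    linarith [hc.2]

/-- If `β > u''` at an interior minimum point, the quadratic form of a fixed bump function tends
to `-∞`. -/
theorem exists_form_tendsto_atBot (h : Profile a b U U₁ U₂ U₃) {m β : ℝ}
    (hm : ∀ y ∈ Icc a b, m ≤ U y) {y₀ : ℝ} (hy₀ : y₀ ∈ Ioo a b) (hU : U y₀ = m)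
    (hβ : U₂ y₀ < β) :
    ∃ η η₁ : ℝ → ℝ, (∀ y, HasDerivAt η (η₁ y) y) ∧ Continuous η₁ ∧ η a = 0 ∧ η b = 0 ∧
      (0 < ∫ y in a..b, η y ^ 2) ∧
      Tendsto (fun c => ∫ y in a..b, (η₁ y ^ 2 + (U₂ y - β) / (U y - c) * η y ^ 2))
        (𝓝[<] m) atBot := by
  have hab : a < b := hy₀.1.trans hy₀.2
  have hy₀' := Ioo_subset_Icc_self hy₀
  have hU₁ : U₁ y₀ = 0 := by
    refine IsLocalMin.hasDerivAt_eq_zero ?_ (h.hasDerivAt₀ y₀)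
    filter_upwards [Icc_mem_nhds hy₀.1 hy₀.2] with z hz
    rw [hU]
    exact hm z hz
  obtain ⟨L, hL, T⟩ := h.taylor
  set k := (β - U₂ y₀) / 2 with hk
  have hk0 : 0 < k := by linarith
  obtain ⟨r, hr, hball⟩ := Metric.eventually_nhds_iff.1
    (h.continuous₂.continuousAt.eventually (gt_mem_nhds (show U₂ y₀ < β - k by linarith)))
  set R := min (min r 1) (min (y₀ - a) (b - y₀))
  have hR : 0 < R := lt_min (lt_min hr one_pos) (lt_min (sub_pos.2 hy₀.1) (sub_pos.2 hy₀.2))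
  have hRr : R ≤ r := (min_le_left _ _).trans (min_le_left _ _)
  have hR1 : R ≤ 1 := (min_le_left _ _).trans (min_le_right _ _)
  have hRa : R ≤ y₀ - a := (min_le_right _ _).trans (min_le_left _ _)
  have hRb : R ≤ b - y₀ := (min_le_right _ _).trans (min_le_right _ _)
  let f : ContDiffBump y₀ := ⟨R / 2, R, by linarith, by linarith⟩
  have hf : ContDiff ℝ 1 f := f.contDiff
  have hfd : ∀ y, HasDerivAt f (deriv f y) y := fun y =>
    (hf.differentiable one_ne_zero y).hasDerivAt
  have hfd' : Continuous (deriv f) := hf.continuous_deriv le_rfl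
  have hfc : Continuous f := hf.continuous
  have hf0 : ∀ y, R ≤ |y - y₀| → f y = 0 := fun y hy => f.zero_of_le_dist (by rwa [Real.dist_eq])
  have hf1 : ∀ y, |y - y₀| ≤ R / 2 → f y = 1 := fun y hy =>
    f.one_of_mem_closedBall (by rwa [Metric.mem_closedBall, Real.dist_eq])
  refine ⟨f, deriv f, hfd, hfd', hf0 a ?_, hf0 b ?_,
    integral_sq_pos hab hfc ⟨y₀, hy₀', ?_⟩, ?_⟩
  · rw [abs_of_neg (sub_neg.2 hy₀.1)]; linarith
  · rw [abs_of_pos (sub_pos.2 hy₀.2)]; linarith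
  · rw [hf1 y₀ (by simp; linarith)]; exact one_ne_zero
  set B := |U₂ y₀| / 2 + L
  have hB : 0 < B := by positivity
  set J := ∫ y in a..b, deriv f y ^ 2
  -- On `[y₀, y₀ + σ]` with `σ = √(m - c)` the bump is 1, the numerator `β - U₂` at least `k`, and
  -- `U - c ≤ (1 + B) σ²`. This window alone contributes `k / ((1 + B) σ)`, and the rest of the
  -- integrand has the same sign.
  have hmain : ∀ᶠ c in 𝓝[<] m,
      ∫ y in a..b, (deriv f y ^ 2 + (U₂ y - β) / (U y - c) * f y ^ 2) ≤
        J - k / (1 + B) * (√(m - c))⁻¹ := by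
    have h0 : ∀ᶠ c in 𝓝[<] m, m - (R / 2) ^ 2 < c :=
      (lt_mem_nhds (by have : 0 < (R / 2) ^ 2 := by positivity
                       linarith)).filter_mono nhdsWithin_le_nhds
    filter_upwards [h0, self_mem_nhdsWithin] with c hc hcm
    have hδ : 0 < m - c := sub_pos.2 hcm
    set σ := √(m - c) with hσ
    have hσ0 : 0 < σ := Real.sqrt_pos.2 hδ
    have hσ2 : σ ^ 2 = m - c := Real.sq_sqrt hδ.le
    have hσR : σ ≤ R / 2 := by
      refine (Real.sqrt_le_sqrt (show m - c ≤ (R / 2) ^ 2 by linarith)).trans ?_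
      rw [Real.sqrt_sq (by positivity)]
    have hDpos : ∀ y ∈ Icc a b, 0 < U y - c := fun y hy => by
      have := hm y hy
      linarith
    have hgc : ContinuousOn (fun y => (β - U₂ y) / (U y - c) * f y ^ 2) (Icc a b) :=
      (((continuous_const.sub h.continuous₂).continuousOn.div
        (h.continuous₀.sub continuous_const).continuousOn fun y hy => (hDpos y hy).ne')).mul
        (hfc.pow 2).continuousOn
    have hgi : ∀ x y, a ≤ x → x ≤ y → y ≤ b →
        IntervalIntegrable (fun y => (β - U₂ y) / (U y - c) * f y ^ 2) volume x y :=
      fun x y hx hxy hy => by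
        apply ContinuousOn.intervalIntegrable
        rw [uIcc_of_le hxy]
        exact hgc.mono (Icc_subset_Icc hx hy)
    have hnear : ∀ y, |y - y₀| < R → k ≤ β - U₂ y := fun y hy => by
      have := hball (y := y) (by rw [Real.dist_eq]; linarith)
      linarith
    have hg0 : ∀ y ∈ Icc a b, 0 ≤ (β - U₂ y) / (U y - c) * f y ^ 2 := fun y hy => by
      rcases lt_or_ge |y - y₀| R with hlt | hge
      · have h1 : 0 ≤ β - U₂ y := hk0.le.trans (hnear y hlt)
        have h2 := hDpos y hy
        positivity
      · rw [hf0 y hge]; simp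
    have hsplit : ∫ y in a..b, (deriv f y ^ 2 + (U₂ y - β) / (U y - c) * f y ^ 2) =
        J - ∫ y in a..b, (β - U₂ y) / (U y - c) * f y ^ 2 := by
      have hJi : IntervalIntegrable (fun y => deriv f y ^ 2) volume a b :=
        (hfd'.pow 2).intervalIntegrable _ _
      rw [← intervalIntegral.integral_sub hJi (hgi a b le_rfl hab.le le_rfl)]
      refine intervalIntegral.integral_congr fun y _ => ?_
      simp only [← neg_sub β (U₂ y), neg_div]
      ring
    have hmono : ∫ y in y₀..(y₀ + σ), (β - U₂ y) / (U y - c) * f y ^ 2 ≤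
        ∫ y in a..b, (β - U₂ y) / (U y - c) * f y ^ 2 := by
      refine intervalIntegral.integral_mono_interval hy₀.1.le (by linarith) (by linarith) ?_
        (hgi a b le_rfl hab.le le_rfl)
      filter_upwards [ae_restrict_mem measurableSet_Ioc] with y hy
      exact hg0 y (Ioc_subset_Icc_self hy)
    have hlow : ∫ _y in y₀..(y₀ + σ), k / ((1 + B) * σ ^ 2) ≤
        ∫ y in y₀..(y₀ + σ), (β - U₂ y) / (U y - c) * f y ^ 2 := by
      refine intervalIntegral.integral_mono_on (by linarith) (by simp)
        (hgi _ _ hy₀.1.le (by linarith) (by linarith)) fun y hy => ?_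
      have hx0 : 0 ≤ y - y₀ := sub_nonneg.2 hy.1
      have hxσ : |y - y₀| ≤ σ := by rw [abs_of_nonneg hx0]; linarith [hy.2]
      have hyI : y ∈ Icc a b := ⟨by linarith [hy.1, hy₀.1], by linarith [hy.2]⟩
      rw [hf1 y (hxσ.trans hσR), one_pow, mul_one]
      have h1 := hnear y (by linarith)
      have t0 := (abs_le.1 (T y₀ hy₀' y hyI).2.2.1).2
      rw [hU₁, hU, ← sq_abs (y - y₀)] at t0
      set x := |y - y₀|
      have hxn : 0 ≤ x := abs_nonneg _
      have hx2 : x ^ 2 ≤ σ ^ 2 := pow_le_pow_left₀ hxn hxσ 2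
      have h2 : U y - c ≤ (1 + B) * σ ^ 2 := by
        have e1 : U₂ y₀ * x ^ 2 / 2 ≤ |U₂ y₀| / 2 * x ^ 2 := by
          have := mul_le_mul_of_nonneg_right (le_abs_self (U₂ y₀)) (sq_nonneg x)
          linarith
        have e2 : L * x ^ 3 ≤ L * x ^ 2 := by
          have hx1 : x ≤ 1 := by linarith
          have : x ^ 3 ≤ x ^ 2 := pow_le_pow_of_le_one hxn hx1 (by norm_num)
          exact mul_le_mul_of_nonneg_left this hL.le
        have e3 : B * x ^ 2 ≤ B * σ ^ 2 := mul_le_mul_of_nonneg_left hx2 hB.le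
        have e4 : B * x ^ 2 = |U₂ y₀| / 2 * x ^ 2 + L * x ^ 2 := by simp only [B]; ring
        linarith
      exact div_le_div₀ (hk0.le.trans h1) h1 (hDpos y hyI) h2
    rw [intervalIntegral.integral_const, add_sub_cancel_left, smul_eq_mul] at hlow
    have e : σ * (k / ((1 + B) * σ ^ 2)) = k / (1 + B) * σ⁻¹ := by field_simp
    rw [hsplit]
    linarith
  refine tendsto_atBot_mono' _ hmain ?_
  have h1 : Tendsto (fun c => √(m - c)) (𝓝[<] m) (𝓝[>] 0) := by
    refine tendsto_nhdsWithin_iff.2 ⟨?_, ?_⟩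
    · have : Continuous fun c => √(m - c) := by fun_prop
      have h2 := this.tendsto m
      simp only [sub_self, Real.sqrt_zero] at h2
      exact h2.mono_left nhdsWithin_le_nhds
    · filter_upwards [self_mem_nhdsWithin] with c hc
      exact Real.sqrt_pos.2 (sub_pos.2 hc)
  have h2 := (tendsto_inv_nhdsGT_zero.comp h1).const_mul_atTop (show 0 < k / (1 + B) by positivity)
  exact tendsto_atBot_add_const_left _ J (tendsto_neg_atTop_atBot.comp h2)

end Profile

/-! ### From quadratic forms to eigenvalues. -/

theorem IsClassicalEigenvalue.congr {a b lam : ℝ} {q q' : ℝ → ℝ} (h : EqOn q q' (Icc a b))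
    (hq : IsClassicalEigenvalue a b q lam) : IsClassicalEigenvalue a b q' lam := by
  obtain ⟨φ, φ₁, φ₂, D₀, D₁, c₂, heq, rest⟩ := hq
  exact ⟨φ, φ₁, φ₂, D₀, D₁, c₂, fun y hy => by rw [heq y hy, h hy], rest⟩

/-- The first eigenvalue exists, and is characterized by the quadratic form. -/
theorem lambda1_spec {a b : ℝ} (hab : a < b) {u Q : ℝ → ℝ} {β c : ℝ}
    (hQ : ContinuousOn Q (Icc a b))
    (hEq : EqOn (fun y => (d2 a b u y - β) / (u y - c)) Q (Icc a b)) :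
    IsLeast {lam | IsEigenvalue a b u β c lam} (lambda1 a b u β c) ∧
      (∀ η η₁ : ℝ → ℝ, (∀ y, HasDerivAt η (η₁ y) y) → Continuous η₁ → η a = 0 → η b = 0 →
        lambda1 a b u β c * ∫ y in a..b, η y ^ 2 ≤ ∫ y in a..b, (η₁ y ^ 2 + Q y * η y ^ 2)) ∧
      (∀ C, (∀ η η₁ : ℝ → ℝ, (∀ y, HasDerivAt η (η₁ y) y) → Continuous η₁ → η a = 0 → η b = 0 →
        0 ≤ ∫ y in a..b, (η₁ y ^ 2 + (Q y + C) * η y ^ 2)) → -C ≤ lambda1 a b u β c) := by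
  have hiff : ∀ lam, IsEigenvalue a b u β c lam ↔ IsClassicalEigenvalue a b Q lam := fun lam =>
    (isEigenvalue_iff_isClassicalEigenvalue hab (hQ.congr hEq)).trans
      ⟨fun h => h.congr hEq, fun h => h.congr hEq.symm⟩
  obtain ⟨l, hl, hform⟩ := exists_first_eigenvalue hab hQ
  have hleast : IsLeast {lam | IsEigenvalue a b u β c lam} l := by
    refine ⟨(hiff l).2 hl, fun lam hlam => ?_⟩
    obtain ⟨φ, φ₁, φ₂, D₀, D₁, c₂, heq, ha, hb, hne⟩ := (hiff lam).1 hlam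
    have h1 := hform φ φ₁ D₀ (continuous_iff_continuousAt.2 fun y => (D₁ y).continuousAt) ha hb
    rw [integral_form_eq_of_eq hab.le hQ D₀ D₁ heq ha hb] at h1
    exact le_of_mul_le_mul_right h1
      (integral_sq_pos hab (continuous_iff_continuousAt.2 fun y => (D₀ y).continuousAt) hne)
  have hl1 : lambda1 a b u β c = l := hleast.csInf_eq
  rw [hl1]
  refine ⟨hleast, hform, fun C hC => ?_⟩
  obtain ⟨φ, φ₁, φ₂, D₀, D₁, c₂, heq, ha, hb, hne⟩ := hl
  have c₁ : Continuous φ₁ := continuous_iff_continuousAt.2 fun y => (D₁ y).continuousAt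
  have c₀ : Continuous φ := continuous_iff_continuousAt.2 fun y => (D₀ y).continuousAt
  have h1 := hC φ φ₁ D₀ c₁ ha hb
  have h2 := form_sub_const (l := -C) hab.le hQ c₀ c₁
  simp only [sub_neg_eq_add] at h2
  rw [h2, integral_form_eq_of_eq hab.le hQ D₀ D₁ heq ha hb, ← sub_mul] at h1
  have := nonneg_of_mul_nonneg_left h1 (integral_sq_pos hab c₀ hne)
  linarith

/-- Data of the problem in terms of a globally defined profile. -/
structure IsExtension (a b : ℝ) (u U U₁ U₂ : ℝ → ℝ) : Prop where
  eqOn₀ : EqOn u U (Icc a b)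
  eqOn₁ : EqOn (d1 a b u) U₁ (Icc a b)
  eqOn₂ : EqOn (d2 a b u) U₂ (Icc a b)

section

variable {a b : ℝ} {u U U₁ U₂ U₃ : ℝ → ℝ}

theorem IsExtension.eqOn_potential (he : IsExtension a b u U U₁ U₂) (β c : ℝ) :
    EqOn (fun y => (d2 a b u y - β) / (u y - c)) (fun y => (U₂ y - β) / (U y - c)) (Icc a b) :=
  fun y hy => by simp only [he.eqOn₂ hy, he.eqOn₀ hy]

/-- A uniform bound of the forms bounds the first eigenvalues. -/
theorem bddBelow_lambda1 (hab : a < b) (h : Profile a b U U₁ U₂ U₃)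
    (he : IsExtension a b u U U₁ U₂) {β : ℝ} {I : Set ℝ} (hI : ∀ c ∈ I, ∀ y ∈ Icc a b, U y ≠ c)
    (hf : FormBound a b I (fun c y => (U₂ y - β) / (U y - c)) a b) :
    BddBelow (lambda1 a b u β '' I) := by
  obtain ⟨C, hC⟩ := hf
  refine ⟨-C, ?_⟩
  rintro _ ⟨c, hc, rfl⟩
  exact (lambda1_spec hab (h.continuousOn_potential (hI c hc)) (he.eqOn_potential β c)).2.2 C
    (hC c hc)

/-- The Rayleigh quotient of one fixed test function bounds the first eigenvalue from above. -/
theorem tendsto_lambda1_atBot (hab : a < b) (h : Profile a b U U₁ U₂ U₃)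
    (he : IsExtension a b u U U₁ U₂) {β : ℝ} {l : Filter ℝ}
    (hl : ∀ᶠ c in l, ∀ y ∈ Icc a b, U y ≠ c) {η η₁ : ℝ → ℝ} (hη : ∀ y, HasDerivAt η (η₁ y) y)
    (hη₁ : Continuous η₁) (ha : η a = 0) (hb : η b = 0) (hpos : 0 < ∫ y in a..b, η y ^ 2)
    (ht : Tendsto (fun c => ∫ y in a..b, (η₁ y ^ 2 + (U₂ y - β) / (U y - c) * η y ^ 2)) l atBot) :
    Tendsto (lambda1 a b u β) l atBot := by
  refine tendsto_atBot_mono' _ ?_ (ht.atBot_div_const hpos)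
  filter_upwards [hl] with c hc
  rw [le_div_iff₀ hpos]
  exact (lambda1_spec hab (h.continuousOn_potential hc) (he.eqOn_potential β c)).2.1 η η₁ hη hη₁
    ha hb

theorem FormBound.neg {a b s t : ℝ} {I : Set ℝ} {q : ℝ → ℝ → ℝ} (h : FormBound a b I q s t) :
    FormBound a b (-I) (fun c => q (-c)) s t := by
  obtain ⟨C, hC⟩ := h
  exact ⟨C, fun c hc => hC (-c) hc⟩

/-- The quadratic forms of the Rayleigh-Kuo problems with `c` above the range of the profile are
uniformly bounded below. -/
theorem Profile.formBound_above (h : Profile a b U U₁ U₂ U₃) (hab : a < b) {m β : ℝ}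
    (hm : ∀ y ∈ Icc a b, U y ≤ m)
    (hcrit : ∀ y ∈ Icc a b, U₁ y = 0 → U y = m → 9 / 8 * U₂ y ≤ β)
    (hint : ∀ y ∈ Ioo a b, U y = m → U₂ y ≤ β) :
    FormBound a b (Ioi m) (fun c y => (U₂ y - β) / (U y - c)) a b := by
  -- The potential is invariant under a simultaneous change of sign of `U`, `β` and `c`.
  have := (h.neg.formBound hab (m := -m) (β := -β) (fun y hy => neg_le_neg (hm y hy))
    (fun y hy h1 h2 => by linarith [hcrit y hy (neg_eq_zero.1 h1) (neg_injective h2)])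
    (fun y hy h2 => by linarith [hint y hy (neg_injective h2)])).neg
  rw [Set.neg_Iio, neg_neg] at this
  convert this using 3 with c y
  rw [← neg_div_neg_eq]
  congr 1 <;> ring

theorem Profile.exists_form_tendsto_atBot_above (h : Profile a b U U₁ U₂ U₃) {m β : ℝ}
    (hm : ∀ y ∈ Icc a b, U y ≤ m) {y₀ : ℝ} (hy₀ : y₀ ∈ Ioo a b) (hU : U y₀ = m)
    (hβ : β < U₂ y₀) :
    ∃ η η₁ : ℝ → ℝ, (∀ y, HasDerivAt η (η₁ y) y) ∧ Continuous η₁ ∧ η a = 0 ∧ η b = 0 ∧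
      (0 < ∫ y in a..b, η y ^ 2) ∧
      Tendsto (fun c => ∫ y in a..b, (η₁ y ^ 2 + (U₂ y - β) / (U y - c) * η y ^ 2))
        (𝓝[>] m) atBot := by
  obtain ⟨η, η₁, hη, hη₁, ha, hb, hpos, ht⟩ := h.neg.exists_form_tendsto_atBot (m := -m) (β := -β)
    (fun y hy => neg_le_neg (hm y hy)) hy₀ (congrArg Neg.neg hU) (neg_lt_neg hβ)
  refine ⟨η, η₁, hη, hη₁, ha, hb, hpos, (ht.comp tendsto_neg_nhdsGT).congr fun c => ?_⟩
  refine intervalIntegral.integral_congr fun y _ => ?_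
  rw [← neg_div_neg_eq]
  congr 3 <;> ring

/-! ### The thresholds in the extended reals. -/

theorem Profile.isCompact_critical (h : Profile a b U U₁ U₂ U₃) (m : ℝ) :
    IsCompact {y | y ∈ Icc a b ∧ U₁ y = 0 ∧ U y = m} :=
  isCompact_Icc.inter_right ((isClosed_eq h.continuous₁ continuous_const).inter
    (isClosed_eq h.continuous₀ continuous_const))

theorem IsExtension.critical_eq (he : IsExtension a b u U U₁ U₂) (m : ℝ) :
    {y | y ∈ Icc a b ∧ d1 a b u y = 0 ∧ u y = m} = {y | y ∈ Icc a b ∧ U₁ y = 0 ∧ U y = m} := by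
  ext y
  simp only [mem_ofPred_eq]
  refine and_congr_right fun hy => ?_
  rw [he.eqOn₁ hy, he.eqOn₀ hy]

theorem coe_nine_eighths_mul (x : ℝ) :
    ((9 / 8 : ℝ) : EReal) * (x : EReal) = ((9 / 8 * x : ℝ) : EReal) := (EReal.coe_mul _ _).symm

theorem le_nine_eighths_mul_of_le {β x : ℝ} {κ : EReal}
    (h : (β : EReal) ≤ ((9 / 8 : ℝ) : EReal) * κ) (hx : κ ≤ (x : EReal)) : β ≤ 9 / 8 * x := by
  have h1 : ((9 / 8 : ℝ) : EReal) * κ ≤ ((9 / 8 : ℝ) : EReal) * (x : EReal) :=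
    mul_le_mul_of_nonneg_left hx (EReal.coe_nonneg.2 (by norm_num))
  rw [coe_nine_eighths_mul] at h1
  exact EReal.coe_le_coe_iff.1 (h.trans h1)

theorem nine_eighths_mul_le_of_le {β x : ℝ} {κ : EReal}
    (h : ((9 / 8 : ℝ) : EReal) * κ ≤ (β : EReal)) (hx : (x : EReal) ≤ κ) : 9 / 8 * x ≤ β := by
  have h1 : ((9 / 8 : ℝ) : EReal) * (x : EReal) ≤ ((9 / 8 : ℝ) : EReal) * κ :=
    mul_le_mul_of_nonneg_left hx (EReal.coe_nonneg.2 (by norm_num))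
  rw [coe_nine_eighths_mul] at h1
  exact EReal.coe_le_coe_iff.1 (h1.trans h)

theorem H1.uMin_le (hu : H1 a b u) {y : ℝ} (hy : y ∈ Icc a b) : uMin a b u ≤ u y :=
  csInf_le (isCompact_Icc.image_of_continuousOn hu.continuousOn).bddBelow (mem_image_of_mem u hy)

theorem H1.le_uMax (hu : H1 a b u) {y : ℝ} (hy : y ∈ Icc a b) : u y ≤ uMax a b u :=
  le_csSup (isCompact_Icc.image_of_continuousOn hu.continuousOn).bddAbove (mem_image_of_mem u hy)

theorem kappaPlus_le {y : ℝ} (hy : y ∈ Icc a b) (h1 : d1 a b u y = 0) (h0 : u y = uMin a b u) :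
    kappaPlus a b u ≤ (d2 a b u y : EReal) := sInf_le ⟨y, ⟨hy, h1, h0⟩, rfl⟩

theorem muPlus_le {y : ℝ} (hy : y ∈ Ioo a b) (h0 : u y = uMin a b u) :
    muPlus a b u ≤ (d2 a b u y : EReal) := sInf_le ⟨y, ⟨hy, h0⟩, rfl⟩

theorem le_kappaMinus {y : ℝ} (hy : y ∈ Icc a b) (h1 : d1 a b u y = 0) (h0 : u y = uMax a b u) :
    (d2 a b u y : EReal) ≤ kappaMinus a b u := le_sSup ⟨y, ⟨hy, h1, h0⟩, rfl⟩

theorem le_muMinus {y : ℝ} (hy : y ∈ Ioo a b) (h0 : u y = uMax a b u) :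
    (d2 a b u y : EReal) ≤ muMinus a b u := le_sSup ⟨y, ⟨hy, h0⟩, rfl⟩

theorem IsExtension.d1_eq_zero_of_uMin (h : Profile a b U U₁ U₂ U₃)
    (he : IsExtension a b u U U₁ U₂) (hu : H1 a b u) {y : ℝ} (hy : y ∈ Ioo a b)
    (h0 : u y = uMin a b u) : d1 a b u y = 0 := by
  rw [he.eqOn₁ (Ioo_subset_Icc_self hy)]
  refine IsLocalMin.hasDerivAt_eq_zero ?_ (h.hasDerivAt₀ y)
  filter_upwards [Icc_mem_nhds hy.1 hy.2] with z hz
  rw [← he.eqOn₀ hz, ← he.eqOn₀ (Ioo_subset_Icc_self hy), h0]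
  exact hu.uMin_le hz

theorem IsExtension.d1_eq_zero_of_uMax (h : Profile a b U U₁ U₂ U₃)
    (he : IsExtension a b u U U₁ U₂) (hu : H1 a b u) {y : ℝ} (hy : y ∈ Ioo a b)
    (h0 : u y = uMax a b u) : d1 a b u y = 0 := by
  rw [he.eqOn₁ (Ioo_subset_Icc_self hy)]
  refine IsLocalMax.hasDerivAt_eq_zero ?_ (h.hasDerivAt₀ y)
  filter_upwards [Icc_mem_nhds hy.1 hy.2] with z hz
  rw [← he.eqOn₀ hz, ← he.eqOn₀ (Ioo_subset_Icc_self hy), h0]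
  exact hu.le_uMax hz

/-- The thresholds are real and positive if the minimum is attained in the interior. -/
theorem exists_kappaPlus_muPlus (hab : a < b) (h : Profile a b U U₁ U₂ U₃)
    (he : IsExtension a b u U U₁ U₂) (hu : H1 a b u)
    (hex : ∃ y ∈ Ioo a b, u y = uMin a b u) :
    ∃ k m : ℝ, 0 < k ∧ 0 < m ∧ kappaPlus a b u = k ∧ muPlus a b u = m := by
  obtain ⟨y₀, hy₀, h0⟩ := hex
  have hZ := h.isCompact_critical (uMin a b u)
  rw [← he.critical_eq] at hZ
  have hmem : ∀ y ∈ Ioo a b, u y = uMin a b u →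
      y ∈ {y | y ∈ Icc a b ∧ d1 a b u y = 0 ∧ u y = uMin a b u} := fun y hy hy0 =>
    ⟨Ioo_subset_Icc_self hy, he.d1_eq_zero_of_uMin h hu hy hy0, hy0⟩
  obtain ⟨z, hz, hzmin⟩ := hZ.exists_isMinOn ⟨y₀, hmem y₀ hy₀ h0⟩ h.continuous₂.continuousOn
  have hzmin' : ∀ y ∈ {y | y ∈ Icc a b ∧ d1 a b u y = 0 ∧ u y = uMin a b u},
      (d2 a b u z : EReal) ≤ (d2 a b u y : EReal) := fun y hy => by
    rw [he.eqOn₂ hz.1, he.eqOn₂ hy.1]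
    exact EReal.coe_le_coe_iff.2 (hzmin hy)
  have hpos : 0 < d2 a b u z := by
    rw [he.eqOn₂ hz.1]
    exact h.snd_deriv_pos hab (m := uMin a b u) (fun y hy => by
      rw [← he.eqOn₀ hy]; exact hu.uMin_le hy) hz.1 (by rw [← he.eqOn₀ hz.1]; exact hz.2.2)
      (by rw [← he.eqOn₁ hz.1]; exact hz.2.1)
  have hκ : kappaPlus a b u = (d2 a b u z : EReal) := by
    refine le_antisymm (kappaPlus_le hz.1 hz.2.1 hz.2.2) (le_sInf ?_)
    rintro _ ⟨y, hy, rfl⟩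
    exact hzmin' y hy
  -- Interior minimum points are critical, so `muPlus` lies between `kappaPlus` and the value at
  -- `y₀`. This makes it real and positive without showing that it is attained.
  have hμ : (d2 a b u z : EReal) ≤ muPlus a b u := by
    refine le_sInf ?_
    rintro _ ⟨y, hy, rfl⟩
    exact hzmin' y (hmem y hy.1 hy.2)
  have hμt : muPlus a b u ≠ ⊤ := ((muPlus_le hy₀ h0).trans_lt (EReal.coe_lt_top _)).ne
  have hμb : muPlus a b u ≠ ⊥ := ((EReal.bot_lt_coe _).trans_le hμ).ne'
  lift muPlus a b u to ℝ using ⟨hμt, hμb⟩ with m hm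
  exact ⟨_, m, hpos, hpos.trans_le (EReal.coe_le_coe_iff.1 hμ), hκ, rfl⟩

/-- The thresholds are real and negative if the maximum is attained in the interior. -/
theorem exists_kappaMinus_muMinus (hab : a < b) (h : Profile a b U U₁ U₂ U₃)
    (he : IsExtension a b u U U₁ U₂) (hu : H1 a b u)
    (hex : ∃ y ∈ Ioo a b, u y = uMax a b u) :
    ∃ k m : ℝ, k < 0 ∧ m < 0 ∧ kappaMinus a b u = k ∧ muMinus a b u = m := by
  obtain ⟨y₀, hy₀, h0⟩ := hex
  have hZ := h.isCompact_critical (uMax a b u)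
  rw [← he.critical_eq] at hZ
  have hmem : ∀ y ∈ Ioo a b, u y = uMax a b u →
      y ∈ {y | y ∈ Icc a b ∧ d1 a b u y = 0 ∧ u y = uMax a b u} := fun y hy hy0 =>
    ⟨Ioo_subset_Icc_self hy, he.d1_eq_zero_of_uMax h hu hy hy0, hy0⟩
  obtain ⟨z, hz, hzmax⟩ := hZ.exists_isMaxOn ⟨y₀, hmem y₀ hy₀ h0⟩ h.continuous₂.continuousOn
  have hzmax' : ∀ y ∈ {y | y ∈ Icc a b ∧ d1 a b u y = 0 ∧ u y = uMax a b u},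
      (d2 a b u y : EReal) ≤ (d2 a b u z : EReal) := fun y hy => by
    rw [he.eqOn₂ hz.1, he.eqOn₂ hy.1]
    exact EReal.coe_le_coe_iff.2 (hzmax hy)
  have hneg : d2 a b u z < 0 := by
    rw [he.eqOn₂ hz.1]
    have := h.neg.snd_deriv_pos hab (m := -uMax a b u) (fun y hy => by
      rw [← he.eqOn₀ hy]; exact neg_le_neg (hu.le_uMax hy)) hz.1
      (by rw [← he.eqOn₀ hz.1, hz.2.2]) (by rw [← he.eqOn₁ hz.1, hz.2.1, neg_zero])
    exact neg_pos.1 this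
  have hκ : kappaMinus a b u = (d2 a b u z : EReal) := by
    refine le_antisymm (sSup_le ?_) (le_kappaMinus hz.1 hz.2.1 hz.2.2)
    rintro _ ⟨y, hy, rfl⟩
    exact hzmax' y hy
  have hμ : muMinus a b u ≤ (d2 a b u z : EReal) := by
    refine sSup_le ?_
    rintro _ ⟨y, hy, rfl⟩
    exact hzmax' y (hmem y hy.1 hy.2)
  have hμb : muMinus a b u ≠ ⊥ := ((EReal.bot_lt_coe _).trans_le (le_muMinus hy₀ h0)).ne'
  have hμt : muMinus a b u ≠ ⊤ := (hμ.trans_lt (EReal.coe_lt_top _)).ne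
  lift muMinus a b u to ℝ using ⟨hμt, hμb⟩ with m hm
  exact ⟨_, m, hneg, (EReal.coe_le_coe_iff.1 hμ).trans_lt hneg, hκ, rfl⟩

/-- Covers interior and endpoint minima together: `hμ` is vacuous if the minimum is not attained
inside, and `hκ` is no restriction if `kappaPlus` is infinite. -/
theorem bddBelow_lambda1_Iio (hab : a < b) (h : Profile a b U U₁ U₂ U₃)
    (he : IsExtension a b u U U₁ U₂) (hu : H1 a b u) {β : ℝ}
    (hκ : (β : EReal) ≤ ((9 / 8 : ℝ) : EReal) * kappaPlus a b u)
    (hμ : ∀ y ∈ Ioo a b, u y = uMin a b u → β ≤ d2 a b u y) :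
    BddBelow (lambda1 a b u β '' Iio (uMin a b u)) := by
  have hm : ∀ y ∈ Icc a b, uMin a b u ≤ U y := fun y hy => by
    rw [← he.eqOn₀ hy]; exact hu.uMin_le hy
  refine bddBelow_lambda1 hab h he (fun c hc y hy => ((mem_Iio.1 hc).trans_le (hm y hy)).ne')
    (h.formBound hab hm (fun y hy h1 h0 => ?_) fun y hy h0 => ?_)
  · rw [← he.eqOn₁ hy] at h1
    rw [← he.eqOn₀ hy] at h0
    rw [← he.eqOn₂ hy]
    exact le_nine_eighths_mul_of_le hκ (kappaPlus_le hy h1 h0)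
  · have hy' := Ioo_subset_Icc_self hy
    rw [← he.eqOn₀ hy'] at h0
    rw [← he.eqOn₂ hy']
    exact hμ y hy h0

theorem bddBelow_lambda1_Ioi (hab : a < b) (h : Profile a b U U₁ U₂ U₃)
    (he : IsExtension a b u U U₁ U₂) (hu : H1 a b u) {β : ℝ}
    (hκ : ((9 / 8 : ℝ) : EReal) * kappaMinus a b u ≤ (β : EReal))
    (hμ : ∀ y ∈ Ioo a b, u y = uMax a b u → d2 a b u y ≤ β) :
    BddBelow (lambda1 a b u β '' Ioi (uMax a b u)) := by
  have hm : ∀ y ∈ Icc a b, U y ≤ uMax a b u := fun y hy => by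
    rw [← he.eqOn₀ hy]; exact hu.le_uMax hy
  refine bddBelow_lambda1 hab h he (fun c hc y hy => ((hm y hy).trans_lt (mem_Ioi.1 hc)).ne)
    (h.formBound_above hab hm (fun y hy h1 h0 => ?_) fun y hy h0 => ?_)
  · rw [← he.eqOn₁ hy] at h1
    rw [← he.eqOn₀ hy] at h0
    rw [← he.eqOn₂ hy]
    exact nine_eighths_mul_le_of_le hκ (le_kappaMinus hy h1 h0)
  · have hy' := Ioo_subset_Icc_self hy
    rw [← he.eqOn₀ hy'] at h0
    rw [← he.eqOn₂ hy']
    exact hμ y hy h0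

theorem tendsto_lambda1_uMin (hab : a < b) (h : Profile a b U U₁ U₂ U₃)
    (he : IsExtension a b u U U₁ U₂) (hu : H1 a b u) {β : ℝ} (hβ : muPlus a b u < (β : EReal)) :
    Tendsto (lambda1 a b u β) (𝓝[<] (uMin a b u)) atBot := by
  have hm : ∀ y ∈ Icc a b, uMin a b u ≤ U y := fun y hy => by
    rw [← he.eqOn₀ hy]; exact hu.uMin_le hy
  obtain ⟨_, ⟨y, ⟨hy, h0⟩, rfl⟩, hlt⟩ := sInf_lt_iff.1 hβ
  have hy' := Ioo_subset_Icc_self hy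
  rw [he.eqOn₀ hy'] at h0
  simp only [he.eqOn₂ hy'] at hlt
  obtain ⟨η, η₁, hη, hη₁, ha, hb, hpos, ht⟩ :=
    h.exists_form_tendsto_atBot hm hy h0 (EReal.coe_lt_coe_iff.1 hlt)
  refine tendsto_lambda1_atBot hab h he ?_ hη hη₁ ha hb hpos ht
  filter_upwards [self_mem_nhdsWithin] with c hc y hy
  exact ((mem_Iio.1 hc).trans_le (hm y hy)).ne'

theorem tendsto_lambda1_uMax (hab : a < b) (h : Profile a b U U₁ U₂ U₃)
    (he : IsExtension a b u U U₁ U₂) (hu : H1 a b u) {β : ℝ} (hβ : (β : EReal) < muMinus a b u) :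
    Tendsto (lambda1 a b u β) (𝓝[>] (uMax a b u)) atBot := by
  have hm : ∀ y ∈ Icc a b, U y ≤ uMax a b u := fun y hy => by
    rw [← he.eqOn₀ hy]; exact hu.le_uMax hy
  obtain ⟨_, ⟨y, ⟨hy, h0⟩, rfl⟩, hlt⟩ := lt_sSup_iff.1 hβ
  have hy' := Ioo_subset_Icc_self hy
  rw [he.eqOn₀ hy'] at h0
  simp only [he.eqOn₂ hy'] at hlt
  obtain ⟨η, η₁, hη, hη₁, ha, hb, hpos, ht⟩ :=
    h.exists_form_tendsto_atBot_above hm hy h0 (EReal.coe_lt_coe_iff.1 hlt)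
  refine tendsto_lambda1_atBot hab h he ?_ hη hη₁ ha hb hpos ht
  filter_upwards [self_mem_nhdsWithin] with c hc y hy
  exact ((hm y hy).trans_lt (mem_Ioi.1 hc)).ne

end

end RayleighKuo

/-! ### Assembly of the four cases. -/

theorem mainTheorem8 (y₁ y₂ : ℝ) (hy : y₁ < y₂) (u : ℝ → ℝ) (hu : RayleighKuo.H1 y₁ y₂ u) :
    -- the smallest eigenvalue exists whenever `c` is outside the range of `u`
    (∀ β c : ℝ, c < RayleighKuo.uMin y₁ y₂ u ∨ RayleighKuo.uMax y₁ y₂ u < c →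
      IsLeast {lam | RayleighKuo.IsEigenvalue y₁ y₂ u β c lam}
        (RayleighKuo.lambda1 y₁ y₂ u β c)) ∧
    -- (1) the minimum is attained at an interior point
    ((∃ y ∈ Ioo y₁ y₂, u y = RayleighKuo.uMin y₁ y₂ u) →
      ∃ βt : ℝ,
        (βt : EReal) = min (((9 / 8 : ℝ) : EReal) * RayleighKuo.kappaPlus y₁ y₂ u)
          (RayleighKuo.muPlus y₁ y₂ u) ∧
        0 < βt ∧ (βt : EReal) ≤ ((9 / 8 : ℝ) : EReal) * RayleighKuo.kappaPlus y₁ y₂ u ∧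
        (∀ β : ℝ, 0 < β → β ≤ βt →
          BddBelow (RayleighKuo.lambda1 y₁ y₂ u β '' Iio (RayleighKuo.uMin y₁ y₂ u))) ∧
        (∀ β : ℝ, βt < β → (β : EReal) ≤ ((9 / 8 : ℝ) : EReal) * RayleighKuo.kappaPlus y₁ y₂ u →
          Tendsto (RayleighKuo.lambda1 y₁ y₂ u β) (𝓝[<] (RayleighKuo.uMin y₁ y₂ u)) atBot)) ∧
    -- (2) the maximum is attained at an interior point
    ((∃ y ∈ Ioo y₁ y₂, u y = RayleighKuo.uMax y₁ y₂ u) →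
      ∃ βt : ℝ,
        (βt : EReal) = max (((9 / 8 : ℝ) : EReal) * RayleighKuo.kappaMinus y₁ y₂ u)
          (RayleighKuo.muMinus y₁ y₂ u) ∧
        βt < 0 ∧ ((9 / 8 : ℝ) : EReal) * RayleighKuo.kappaMinus y₁ y₂ u ≤ (βt : EReal) ∧
        (∀ β : ℝ, β < 0 → βt ≤ β →
          BddBelow (RayleighKuo.lambda1 y₁ y₂ u β '' Ioi (RayleighKuo.uMax y₁ y₂ u))) ∧
        (∀ β : ℝ, β < βt → ((9 / 8 : ℝ) : EReal) * RayleighKuo.kappaMinus y₁ y₂ u ≤ (β : EReal) →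
          Tendsto (RayleighKuo.lambda1 y₁ y₂ u β) (𝓝[>] (RayleighKuo.uMax y₁ y₂ u)) atBot)) ∧
    -- (3) the minimum is not attained at an interior point
    ((¬ ∃ y ∈ Ioo y₁ y₂, u y = RayleighKuo.uMin y₁ y₂ u) →
      ∀ β : ℝ, 0 < β → (β : EReal) ≤ ((9 / 8 : ℝ) : EReal) * RayleighKuo.kappaPlus y₁ y₂ u →
        BddBelow (RayleighKuo.lambda1 y₁ y₂ u β '' Iio (RayleighKuo.uMin y₁ y₂ u))) ∧
    -- (4) the maximum is not attained at an interior point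
    ((¬ ∃ y ∈ Ioo y₁ y₂, u y = RayleighKuo.uMax y₁ y₂ u) →
      ∀ β : ℝ, β < 0 → ((9 / 8 : ℝ) : EReal) * RayleighKuo.kappaMinus y₁ y₂ u ≤ (β : EReal) →
        BddBelow (RayleighKuo.lambda1 y₁ y₂ u β '' Ioi (RayleighKuo.uMax y₁ y₂ u))) := by
  obtain ⟨U, U₁, U₂, U₃, h, e₀, e₁, e₂⟩ := hu.exists_profile hy
  have he : RayleighKuo.IsExtension y₁ y₂ u U U₁ U₂ := ⟨e₀, e₁, e₂⟩
  refine ⟨fun β c hc => ?_, fun hex => ?_, fun hex => ?_, fun hnex β _ hβ => ?_,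
    fun hnex β _ hβ => ?_⟩
  · refine (RayleighKuo.lambda1_spec hy (h.continuousOn_potential fun y hy' => ?_)
      (he.eqOn_potential β c)).1
    rw [← e₀ hy']
    rcases hc with hc | hc
    · exact (hc.trans_le (hu.uMin_le hy')).ne'
    · exact ((hu.le_uMax hy').trans_lt hc).ne
  · obtain ⟨k, m, hk, hm, hκ, hμ⟩ := RayleighKuo.exists_kappaPlus_muPlus hy h he hu hex
    have hκ' : ((9 / 8 : ℝ) : EReal) * RayleighKuo.kappaPlus y₁ y₂ u = ((9 / 8 * k : ℝ) : EReal) := by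
      rw [hκ, RayleighKuo.coe_nine_eighths_mul]
    refine ⟨min (9 / 8 * k) m, ?_, lt_min (by positivity) hm, ?_, fun β _ hβ => ?_,
      fun β hβ hβκ => ?_⟩
    · rw [hκ', hμ]
      exact EReal.coe_strictMono.monotone.map_min
    · rw [hκ']
      exact EReal.coe_le_coe_iff.2 (min_le_left _ _)
    · refine RayleighKuo.bddBelow_lambda1_Iio hy h he hu ?_ fun y hyI h0 => ?_
      · rw [hκ']
        exact EReal.coe_le_coe_iff.2 (hβ.trans (min_le_left _ _))
      · have h1 := RayleighKuo.muPlus_le hyI h0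
        rw [hμ] at h1
        exact (hβ.trans (min_le_right _ _)).trans (EReal.coe_le_coe_iff.1 h1)
    · refine RayleighKuo.tendsto_lambda1_uMin hy h he hu ?_
      rw [hκ', EReal.coe_le_coe_iff] at hβκ
      rw [hμ, EReal.coe_lt_coe_iff]
      -- Below `9/8` of `kappaPlus`, exceeding the minimum of the two thresholds means exceeding
      -- `muPlus`.
      exact (min_lt_iff.1 hβ).resolve_left hβκ.not_gt
  · obtain ⟨k, m, hk, hm, hκ, hμ⟩ := RayleighKuo.exists_kappaMinus_muMinus hy h he hu hex
    have hκ' : ((9 / 8 : ℝ) : EReal) * RayleighKuo.kappaMinus y₁ y₂ u =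
        ((9 / 8 * k : ℝ) : EReal) := by
      rw [hκ, RayleighKuo.coe_nine_eighths_mul]
    refine ⟨max (9 / 8 * k) m, ?_, max_lt (by linarith) hm, ?_, fun β _ hβ => ?_,
      fun β hβ hβκ => ?_⟩
    · rw [hκ', hμ]
      exact EReal.coe_strictMono.monotone.map_max
    · rw [hκ']
      exact EReal.coe_le_coe_iff.2 (le_max_left _ _)
    · refine RayleighKuo.bddBelow_lambda1_Ioi hy h he hu ?_ fun y hyI h0 => ?_
      · rw [hκ']
        exact EReal.coe_le_coe_iff.2 ((le_max_left _ _).trans hβ)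
      · have h1 := RayleighKuo.le_muMinus hyI h0
        rw [hμ] at h1
        exact (EReal.coe_le_coe_iff.1 h1).trans ((le_max_right _ _).trans hβ)
    · refine RayleighKuo.tendsto_lambda1_uMax hy h he hu ?_
      rw [hκ', EReal.coe_le_coe_iff] at hβκ
      rw [hμ, EReal.coe_lt_coe_iff]
      exact (lt_max_iff.1 hβ).resolve_left hβκ.not_gt
  · exact RayleighKuo.bddBelow_lambda1_Iio hy h he hu hβ fun y hyI h0 =>
      absurd ⟨y, hyI, h0⟩ hnex
  · exact RayleighKuo.bddBelow_lambda1_Ioi hy h he hu hβ fun y hyI h0 =>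
      absurd ⟨y, hyI, h0⟩ hnex
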